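/- Let $n\ge 1$, let $K$ be a field and let $\Lambda$ be a finite dimensional $K$-algebra. Let $\operatorname{mod}\Lambda$ be the category of finitely generated right $\Lambda$-modules and $\mathcal D_\Lambda$ its bounded derived category; put $D=\operatorname{Hom}_K(-,K)$, $\nu=D\,\mathbf R\mathrm{Hom}_\Lambda(-,\Lambda)$, $\nu^{-1}=\mathbf R\mathrm{Hom}_{\Lambda^{\mathrm{op}}}(D-,\Lambda)$, $\nu_n=\nu\circ[-n]$ and $\nu_n^{-1}=\nu^{-1}\circ[n]$. Suppose that $\Lambda$ is $n$-hereditary, that is, $\operatorname{gl.dim}\Lambda\le n$ and $H^k(\nu_n^i(\Lambda))=0$ for all $i\in\mathbb Z$ and all $k\in\mathbb Z\setminus n\mathbb Z$. Let $\mathcal U=\operatorname{add}\{\nu_n^i(\Lambda)\mid i\in\mathbb Z\}$, let $\mathcal C$ be the full subcategory of those $X\in\mathcal D_\Lambda$ such that $\operatorname{Hom}_{\mathcal D_\Lambda}(U,X[i])=0$ for all $U\in\mathcal U$ and all $i\in\mathbb Z\setminus n\mathbb Z$, and let $\mathcal C^0=\operatorname{mod}\Lambda\cap\mathcal C$. Let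 $K_0(\mathcal C^0)$ be the quotient of the split Grothendieck group of the additive category $\mathcal C^0$ by the subgroup generated by the elements $\sum_{i=0}^{n+1}(-1)^i[X_i]$, one for each exact sequence $0\to X_{n+1}\to\cdots\to X_0\to 0$ in $\operatorname{mod}\Lambda$ with all terms in $\mathcal C^0$, and let $K_0(\operatorname{mod}\Lambda)$ be the usual Grothendieck group of the abelian category $\operatorname{mod}\Lambda$. Write $[X]_{\mathcal C^0}$ and $[X]$ for the classes of $X$ in these two groups. Then every finitely generated projective right $\Lambda$-module lies in $\mathcal C^0$, and there is a group isomorphism $$\alpha\colon K_0(\mathcal C^0)\xrightarrow{\ \sim\ }K_0(\operatorname{mod}\Lambda),\qquad \alpha([X]_{\mathcal C^0})=[X]\quad(X\in\mathcal C^0).$$ Every $X\in\operatorname{mod}\Lambda$ has a projective resolution $0\to P_n\to\cdots\to P_0\to X\to 0$ in $\operatorname{mod}\Lambda$, and for every such resolution $$\alpha^{-1}([X])=\sum_{i=0}^{n}(-1)^i[P_i]_{\mathcal C^0}.$$ -/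

import Mathlib

open CategoryTheory CategoryTheory.Limits
open scoped ZeroObject

universe u v

noncomputable section

/-! ### Module categories of finite dimensional algebras -/

/-- For a finite dimensional `K`-algebra `A`, the category of finitely generated left `A`-modules.
The category `mod Λ` of finitely generated right `Λ`-modules is `FMod K Λᵐᵒᵖ`. -/
def FMod (K A : Type u) [Field K] [Ring A] [Algebra K A] [Module.Finite K A] : Type (u + 1) :=
  FGModuleCat.{u} A

namespace FMod

section

variable (K A : Type u) [Field K] [Ring A] [Algebra K A] [Module.Finite K A]

instance : Category.{u} (FMod K A) := inferInstanceAs (Category.{u} (FGModuleCat.{u} A))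

instance : Abelian (FMod K A) :=
  haveI : IsNoetherianRing A := IsNoetherianRing.of_finite K A
  inferInstanceAs (Abelian (FGModuleCat.{u} A))

instance : HasDerivedCategory.{u + 1} (FMod K A) := HasDerivedCategory.standard (FMod K A)

variable {K A}

instance : CoeSort (FMod K A) (Type u) := ⟨fun M => FGModuleCat.carrier M⟩

instance (M : FMod K A) : AddCommGroup M := inferInstanceAs (AddCommGroup (ModuleCat.carrier M.obj))
instance (M : FMod K A) : Module A M := inferInstanceAs (Module A (ModuleCat.carrier M.obj))
instance (M : FMod K A) : Module.Finite A M := M.property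
instance (M : FMod K A) : Module K M := Module.restrictScalars K A M
instance (M : FMod K A) : IsScalarTower K A M := IsScalarTower.restrictScalars K A M
instance (M : FMod K A) : Module.Finite K M := Module.Finite.trans A M

/-- A finite dimensional module over the `K`-algebra `A` as an object of `FMod K A`. -/
def of (M : Type u) [AddCommGroup M] [Module A M] [Module.Finite A M] : FMod K A :=
  FGModuleCat.of A M

/-- The `A`-linear map underlying a morphism. -/
def lin {M N : FMod K A} (f : M ⟶ N) : M →ₗ[A] N := f.hom.hom

/-- The morphism given by an `A`-linear map. -/
def ofLin {M N : FMod K A} (f : M →ₗ[A] N) : M ⟶ N := FGModuleCat.ofHom f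

lemma hom_ext {M N : FMod K A} {f g : M ⟶ N} (h : ∀ x, lin f x = lin g x) : f = g :=
  FGModuleCat.hom_ext (LinearMap.ext h)

end

/-- The `K`-dual `D M = Hom_K(M, K)` of a module `M`. -/
def Dual {K A : Type u} [Field K] [Ring A] [Algebra K A] [Module.Finite K A] (M : FMod K A) :
    Type u := M →ₗ[K] K

section

variable {K Λ : Type u} [Field K] [Ring Λ] [Algebra K Λ] [Module.Finite K Λ]

instance (M : FMod K Λ) : AddCommGroup (Dual M) := inferInstanceAs (AddCommGroup (M →ₗ[K] K))
instance (M : FMod K Λ) : Module K (Dual M) := inferInstanceAs (Module K (M →ₗ[K] K))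
instance (M : FMod K Λ) : Module.Finite K (Dual M) :=
  inferInstanceAs (Module.Finite K (M →ₗ[K] K))

instance (M : FMod K Λ) : FunLike (Dual M) M K := inferInstanceAs (FunLike (M →ₗ[K] K) M K)
instance (M : FMod K Λ) : LinearMapClass (Dual M) K M K :=
  inferInstanceAs (LinearMapClass (M →ₗ[K] K) K M K)

/-- The dual of a left `Λ`-module is a right `Λ`-module by `(f a)(x) = f (a x)`. -/
instance (M : FMod K Λ) : Module Λᵐᵒᵖ (Dual M) where
  smul a f := LinearMap.comp (M₂ := M) f (Algebra.lsmul K K M a.unop)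
  one_smul f := LinearMap.ext fun x => congrArg f (one_smul Λ x)
  mul_smul a b f := LinearMap.ext fun x =>
    congrArg f (mul_smul b.unop a.unop x)
  smul_zero _ := rfl
  smul_add _ _ _ := rfl
  add_smul a b f := LinearMap.ext fun x =>
    (congrArg f (add_smul a.unop b.unop x)).trans (map_add f _ _)
  zero_smul f := LinearMap.ext fun x =>
    (congrArg f (zero_smul Λ x)).trans (map_zero f)

/-- The dual of a right `Λ`-module is a left `Λ`-module by `(a f)(x) = f (x a)`. -/
instance (M : FMod K Λᵐᵒᵖ) : Module Λ (Dual M) where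
  smul a f := LinearMap.comp (M₂ := M) f (Algebra.lsmul K K M (MulOpposite.op a))
  one_smul f := LinearMap.ext fun x => congrArg f (one_smul Λᵐᵒᵖ x)
  mul_smul a b f := LinearMap.ext fun x =>
    congrArg f (mul_smul (MulOpposite.op b) (MulOpposite.op a) x)
  smul_zero _ := rfl
  smul_add _ _ _ := rfl
  add_smul a b f := LinearMap.ext fun x =>
    (congrArg f (add_smul (MulOpposite.op a) (MulOpposite.op b) x)).trans
      (map_add f _ _)
  zero_smul f := LinearMap.ext fun x =>
    (congrArg f (zero_smul Λᵐᵒᵖ x)).trans (map_zero f)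

instance (M : FMod K Λ) : IsScalarTower K Λᵐᵒᵖ (Dual M) :=
  .of_algebraMap_smul fun r f => LinearMap.ext fun x =>
    (congrArg f (algebraMap_smul Λ r x)).trans (map_smul f r x)

instance (M : FMod K Λᵐᵒᵖ) : IsScalarTower K Λ (Dual M) :=
  .of_algebraMap_smul fun r f => LinearMap.ext fun x =>
    (congrArg f (algebraMap_smul Λᵐᵒᵖ r x)).trans (map_smul f r x)

instance (M : FMod K Λ) : Module.Finite Λᵐᵒᵖ (Dual M) :=
  .of_restrictScalars_finite K Λᵐᵒᵖ (Dual M)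

instance (M : FMod K Λᵐᵒᵖ) : Module.Finite Λ (Dual M) :=
  .of_restrictScalars_finite K Λ (Dual M)

/-- The duality `D = Hom_K(-, K)` from left to right `Λ`-modules. -/
def dualLeft : (FMod K Λ)ᵒᵖ ⥤ FMod K Λᵐᵒᵖ where
  obj M := of (Dual M.unop)
  map {M N} f := ofLin (M := of (Dual M.unop)) (N := of (Dual N.unop))
    { toFun := fun g => LinearMap.comp (M₂ := M.unop) g ((lin f.unop).restrictScalars K)
      map_add' := fun _ _ => rfl
      map_smul' := fun a (g : Dual M.unop) => LinearMap.ext fun x =>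
        congrArg g (map_smul (lin f.unop) a.unop x).symm }

/-- The duality `D = Hom_K(-, K)` from right to left `Λ`-modules. -/
def dualRight : (FMod K Λᵐᵒᵖ)ᵒᵖ ⥤ FMod K Λ where
  obj M := of (Dual M.unop)
  map {M N} f := ofLin (M := of (Dual M.unop)) (N := of (Dual N.unop))
    { toFun := fun g => LinearMap.comp (M₂ := M.unop) g ((lin f.unop).restrictScalars K)
      map_add' := fun _ _ => rfl
      map_smul' := fun a (g : Dual M.unop) => LinearMap.ext fun x =>
        congrArg g (map_smul (lin f.unop) (MulOpposite.op a) x).symm }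

instance (M : FMod K Λ) : Module.Finite Λᵐᵒᵖ (M →ₗ[Λ] Λ) :=
  .of_restrictScalars_finite K Λᵐᵒᵖ (M →ₗ[Λ] Λ)

instance (M : FMod K Λᵐᵒᵖ) : Module.Finite Λ (M →ₗ[Λᵐᵒᵖ] Λ) :=
  .of_restrictScalars_finite K Λ (M →ₗ[Λᵐᵒᵖ] Λ)

/-- The functor `Hom_{Λᵒᵖ}(-, Λ)` from left to right `Λ`-modules, with `(f a)(x) = f(x) a`. -/
def homLeft : (FMod K Λ)ᵒᵖ ⥤ FMod K Λᵐᵒᵖ where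
  obj M := of (M.unop →ₗ[Λ] Λ)
  map {M N} f := ofLin (M := of (M.unop →ₗ[Λ] Λ)) (N := of (N.unop →ₗ[Λ] Λ))
    { toFun := fun g => LinearMap.comp (M₂ := M.unop) g (lin f.unop)
      map_add' := fun _ _ => rfl
      map_smul' := fun _ _ => rfl }

/-- The functor `Hom_Λ(-, Λ)` from right to left `Λ`-modules, with `(a f)(x) = a f(x)`. -/
def homRight : (FMod K Λᵐᵒᵖ)ᵒᵖ ⥤ FMod K Λ where
  obj M := of (M.unop →ₗ[Λᵐᵒᵖ] Λ)
  map {M N} f := ofLin (M := of (M.unop →ₗ[Λᵐᵒᵖ] Λ)) (N := of (N.unop →ₗ[Λᵐᵒᵖ] Λ))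
    { toFun := fun g => LinearMap.comp (M₂ := M.unop) g (lin f.unop)
      map_add' := fun _ _ => rfl
      map_smul' := fun _ _ => rfl }

variable (K Λ)

/-- The Nakayama functor `D Hom_Λ(-, Λ)` on `mod Λ`. -/
def nu₀ : FMod K Λᵐᵒᵖ ⥤ FMod K Λᵐᵒᵖ := homRight.rightOp ⋙ dualLeft

/-- The functor `Hom_{Λᵒᵖ}(D -, Λ)` on `mod Λ`. -/
def nuInv₀ : FMod K Λᵐᵒᵖ ⥤ FMod K Λᵐᵒᵖ := dualRight.rightOp ⋙ homLeft

instance : (nu₀ K Λ).Additive where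
  map_add {M N} f g := hom_ext (N := (nu₀ K Λ).obj N) 
    fun (φ : Dual (of (M →ₗ[Λᵐᵒᵖ] Λ))) => LinearMap.ext fun (ψ : N →ₗ[Λᵐᵒᵖ] Λ) =>
    (congrArg φ (LinearMap.ext fun x => map_add ψ (lin f x) (lin g x) :
      LinearMap.comp (M₂ := N) ψ (lin (f + g)) =
        LinearMap.comp (M₂ := N) ψ (lin f) + LinearMap.comp (M₂ := N) ψ (lin g))).trans
      (map_add φ _ _)

instance : (nuInv₀ K Λ).Additive where
  map_add {M N} f g := hom_ext (N := (nuInv₀ K Λ).obj N) 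
    fun (φ : Dual M →ₗ[Λ] Λ) => LinearMap.ext fun (ψ : Dual N) =>
    (congrArg φ (LinearMap.ext fun x => map_add ψ (lin f x) (lin g x) :
      LinearMap.comp (M₂ := N) ψ ((lin (f + g)).restrictScalars K) =
        LinearMap.comp (M₂ := N) ψ ((lin f).restrictScalars K) +
          LinearMap.comp (M₂ := N) ψ ((lin g).restrictScalars K))).trans
      (map_add φ (LinearMap.comp (M₂ := N) ψ ((lin f).restrictScalars K) : Dual M)
        (LinearMap.comp (M₂ := N) ψ ((lin g).restrictScalars K) : Dual M))

/-- The right module `Λ` over `Λ`. -/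
def regular : FMod K Λᵐᵒᵖ :=
  haveI : Module.Finite Λᵐᵒᵖ Λ := .of_restrictScalars_finite K Λᵐᵒᵖ Λ
  of Λ

end

end FMod

/-! ### The derived Nakayama functor and `n`-hereditary algebras -/

section Derived

variable (K Λ : Type u) [Field K] [Ring Λ] [Algebra K Λ] [Module.Finite K Λ]

/-- The derived category of `mod Λ`. The bounded derived category `𝒟_Λ` is its full subcategory
on the objects satisfying `DerivedCategory.TStructure.t.bounded`. -/
abbrev DMod : Type (u + 1) := DerivedCategory (FMod K Λᵐᵒᵖ)

variable {K Λ}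

/-- `P` is a bounded complex of finitely generated projective right `Λ`-modules which is isomorphic
to `X` in the derived category. -/
structure IsProjectiveModel (X : DMod K Λ) (P : CochainComplex (FMod K Λᵐᵒᵖ) ℤ) : Prop where
  bounded : ∃ a b : ℤ, P.IsStrictlyGE a ∧ P.IsStrictlyLE b
  projective : ∀ i, Projective (P.X i)
  iso : Nonempty (DerivedCategory.Q.obj P ≅ X)

/-- `I` is a bounded complex of finitely generated injective right `Λ`-modules which is isomorphic
to `X` in the derived category. -/
structure IsInjectiveModel (X : DMod K Λ) (I : CochainComplex (FMod K Λᵐᵒᵖ) ℤ) : Prop where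
  bounded : ∃ a b : ℤ, I.IsStrictlyGE a ∧ I.IsStrictlyLE b
  injective : ∀ i, Injective (I.X i)
  iso : Nonempty (DerivedCategory.Q.obj I ≅ X)

open Classical in
/-- The derived Nakayama functor `ν = D RHom_Λ(-, Λ)` on objects: apply `D Hom_Λ(-, Λ)` to the terms
of a bounded projective resolution of `X`. Up to isomorphism this does not depend on the choice
(see `nu_iso`), and a bounded projective resolution exists for every bounded `X` if `Λ` has finite
global dimension. -/
def nu (X : DMod K Λ) : DMod K Λ :=
  if h : ∃ P, IsProjectiveModel X P then
    DerivedCategory.Q.obj (((FMod.nu₀ K Λ).mapHomologicalComplex _).obj h.choose)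
  else 0

open Classical in
/-- The functor `ν⁻¹ = RHom_{Λᵒᵖ}(D -, Λ)` on objects: apply `Hom_{Λᵒᵖ}(D -, Λ)` to the terms of a
bounded injective resolution `I` of `X` (then `D I` is a projective resolution of `D X`). Up to
isomorphism this does not depend on the choice (see `nuInv_iso`), and a bounded injective resolution
exists for every bounded `X` if `Λ` has finite global dimension. -/
def nuInv (X : DMod K Λ) : DMod K Λ :=
  if h : ∃ I, IsInjectiveModel X I then
    DerivedCategory.Q.obj (((FMod.nuInv₀ K Λ).mapHomologicalComplex _).obj h.choose)
  else 0

lemma nonempty_iso_of_Qh_map_bijective {C : Type*} [Category* C] [Abelian C] [HasDerivedCategory C]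
    (F : C ⥤ C) [F.Additive] {L M : CochainComplex C ℤ}
    (h : ∀ A ∈ ({L, M} : Set (CochainComplex C ℤ)), ∀ B ∈ ({L, M} : Set (CochainComplex C ℤ)),
      Function.Bijective (DerivedCategory.Qh.map : ((HomotopyCategory.quotient _ _).obj A ⟶
        (HomotopyCategory.quotient _ _).obj B) → _))
    (e : DerivedCategory.Q.obj L ≅ DerivedCategory.Q.obj M) :
    Nonempty (DerivedCategory.Q.obj ((F.mapHomologicalComplex _).obj L) ≅
      DerivedCategory.Q.obj ((F.mapHomologicalComplex _).obj M)) := by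
  let e' := (DerivedCategory.quotientCompQhIso C).app L ≪≫ e ≪≫
    ((DerivedCategory.quotientCompQhIso C).app M).symm
  obtain ⟨f, hf⟩ := (h L (by simp) M (by simp)).surjective e'.hom
  obtain ⟨g, hg⟩ := (h M (by simp) L (by simp)).surjective e'.inv
  have h₁ : f ≫ g = 𝟙 _ := (h L (by simp) L (by simp)).injective (by
    rw [Functor.map_comp, hf, hg, e'.hom_inv_id, CategoryTheory.Functor.map_id]; rfl)
  have h₂ : g ≫ f = 𝟙 _ := (h M (by simp) M (by simp)).injective (by
    rw [Functor.map_comp, hf, hg, e'.inv_hom_id, CategoryTheory.Functor.map_id]; rfl)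
  let ε : (HomotopyCategory.quotient C (.up ℤ)).obj L ≅ (HomotopyCategory.quotient C (.up ℤ)).obj M :=
    ⟨f, g, h₁, h₂⟩
  exact ⟨((DerivedCategory.quotientCompQhIso C).app _).symm ≪≫
    DerivedCategory.Qh.mapIso (((F.mapHomotopyCategoryFactors _).app L).symm ≪≫
      (F.mapHomotopyCategory _).mapIso ε ≪≫ (F.mapHomotopyCategoryFactors _).app M) ≪≫
    (DerivedCategory.quotientCompQhIso C).app _⟩

lemma nu_iso {X : DMod K Λ} {P : CochainComplex (FMod K Λᵐᵒᵖ) ℤ} (hP : IsProjectiveModel X P) :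
    Nonempty (nu X ≅ DerivedCategory.Q.obj (((FMod.nu₀ K Λ).mapHomologicalComplex _).obj P)) := by
  have h : ∃ P, IsProjectiveModel X P := ⟨P, hP⟩
  rw [nu, dif_pos h]
  have key : ∀ {L : CochainComplex (FMod K Λᵐᵒᵖ) ℤ}, IsProjectiveModel X L → L.IsKProjective := by
    intro L hL
    obtain ⟨_, b, _, _⟩ := hL.bounded
    have := hL.projective
    exact CochainComplex.isKProjective_of_projective L b
  refine nonempty_iso_of_Qh_map_bijective _ ?_ (h.choose_spec.iso.some ≪≫ hP.iso.some.symm)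
  rintro A hA B -
  have : A.IsKProjective := by
    rcases hA with rfl | rfl
    exacts [key h.choose_spec, key hP]
  exact CochainComplex.IsKProjective.Qh_map_bijective _ _

lemma nuInv_iso {X : DMod K Λ} {I : CochainComplex (FMod K Λᵐᵒᵖ) ℤ} (hI : IsInjectiveModel X I) :
    Nonempty (nuInv X ≅
      DerivedCategory.Q.obj (((FMod.nuInv₀ K Λ).mapHomologicalComplex _).obj I)) := by
  have h : ∃ I, IsInjectiveModel X I := ⟨I, hI⟩
  rw [nuInv, dif_pos h]
  have key : ∀ {L : CochainComplex (FMod K Λᵐᵒᵖ) ℤ}, IsInjectiveModel X L → L.IsKInjective := by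
    intro L hL
    obtain ⟨a, _, _, _⟩ := hL.bounded
    have := hL.injective
    exact CochainComplex.isKInjective_of_injective L a
  refine nonempty_iso_of_Qh_map_bijective _ ?_ (h.choose_spec.iso.some ≪≫ hI.iso.some.symm)
  rintro A - B hB
  have : B.IsKInjective := by
    rcases hB with rfl | rfl
    exacts [key h.choose_spec, key hI]
  exact CochainComplex.IsKInjective.Qh_map_bijective _ _

variable (K Λ)

/-- `ν_n^i(Λ)` for an integer `i`, where `ν_n = ν ∘ [-n]` and `ν_n⁻¹ = ν⁻¹ ∘ [n]`. -/
def nuPow (n : ℕ) : ℤ → DMod K Λ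
  | .ofNat i => (fun X => nu (X⟦-(n : ℤ)⟧))^[i]
      ((DerivedCategory.singleFunctor _ 0).obj (FMod.regular K Λ))
  | .negSucc i => (fun X => nuInv (X⟦(n : ℤ)⟧))^[i + 1]
      ((DerivedCategory.singleFunctor _ 0).obj (FMod.regular K Λ))

/-- A finite dimensional algebra `Λ` is `n`-hereditary if it has global dimension at most `n` and,
for every integer `i`, the cohomology of `ν_n^i(Λ)` is concentrated in degrees divisible by `n`. -/
structure IsNHereditary (n : ℕ) : Prop where
  gldim : ∀ X : FMod K Λᵐᵒᵖ, HasProjectiveDimensionLE X n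
  isZero_homology : ∀ i k : ℤ, ¬ (n : ℤ) ∣ k →
    IsZero ((DerivedCategory.homologyFunctor _ k).obj (nuPow K Λ n i))

/-- The subcategory `𝒰 = add {ν_n^i(Λ) | i ∈ ℤ}`: direct summands of finite direct sums. -/
def catU (n : ℕ) : ObjectProperty (DMod K Λ) := fun U =>
  ∃ (m : ℕ) (j : Fin m → ℤ) (V : DMod K Λ), Nonempty (U ⊞ V ≅ ⨁ fun k => nuPow K Λ n (j k))

/-- The subcategory `𝒞` of the bounded derived category: the objects `X` such that
`Hom(𝒰, X[i]) = 0` for every integer `i` not divisible by `n`. -/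
def catC (n : ℕ) : ObjectProperty (DMod K Λ) := fun X =>
  DerivedCategory.TStructure.t.bounded X ∧
    ∀ U, catU K Λ n U → ∀ i : ℤ, ¬ (n : ℤ) ∣ i → ∀ f : U ⟶ X⟦i⟧, f = 0

/-- The subcategory `𝒞⁰ = mod Λ ∩ 𝒞` of `mod Λ`. -/
def catC0 (n : ℕ) : ObjectProperty (FMod K Λᵐᵒᵖ) := fun X =>
  catC K Λ n ((DerivedCategory.singleFunctor _ 0).obj X)

end Derived

/-! ### Grothendieck groups -/

section Grothendieck

variable (C : Type u) [Category.{v} C]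

/-- The split Grothendieck group of an additive category: the free abelian group on the objects
modulo `[X] = [Y]` for `X ≅ Y` and `[X ⊕ Y] = [X] + [Y]`. -/
def SplitK0 [Preadditive C] : Type u :=
  FreeAbelianGroup C ⧸ AddSubgroup.closure
    ({r : FreeAbelianGroup C | ∃ X Y : C, Nonempty (X ≅ Y) ∧
        r = FreeAbelianGroup.of X - FreeAbelianGroup.of Y} ∪
      {r | ∃ (X Y : C) (b : BinaryBicone X Y), Nonempty b.IsBilimit ∧
        r = FreeAbelianGroup.of b.pt - FreeAbelianGroup.of X - FreeAbelianGroup.of Y})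

instance [Preadditive C] : AddCommGroup (SplitK0 C) :=
  inferInstanceAs (AddCommGroup (FreeAbelianGroup C ⧸ AddSubgroup.closure _))

variable {C} in
/-- The class `[X]₀` of an object in the split Grothendieck group. -/
def SplitK0.cls [Preadditive C] (X : C) : SplitK0 C :=
  QuotientAddGroup.mk (FreeAbelianGroup.of X)

/-- The Grothendieck group of an abelian category: the split Grothendieck group modulo
`[X] - [Y] + [Z]` for the short exact sequences `0 → X → Y → Z → 0`. -/
def K0 [Abelian C] : Type u :=
  SplitK0 C ⧸ AddSubgroup.closure {r : SplitK0 C | ∃ S : ShortComplex C, S.ShortExact ∧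
    r = SplitK0.cls S.X₁ - SplitK0.cls S.X₂ + SplitK0.cls S.X₃}

instance [Abelian C] : AddCommGroup (K0 C) :=
  inferInstanceAs (AddCommGroup (SplitK0 C ⧸ AddSubgroup.closure _))

variable {C}

/-- The class `[X]` of an object in the Grothendieck group of an abelian category. -/
def K0.cls [Abelian C] (X : C) : K0 C := QuotientAddGroup.mk (SplitK0.cls X)

/-- The Grothendieck group of a full additive subcategory `S` of an abelian category with respect to
exact sequences with `n + 2` terms: the split Grothendieck group of `S` modulo
`∑ (-1)^i [X_i]` for the sequences `0 → X_{n+1} → ⋯ → X_0 → 0` with terms in `S` that are exact in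
the ambient category. Such a sequence is a chain complex `E` in `S` that is zero in degrees `> n + 1`
and whose image in the ambient category is exact in every degree. -/
def ExactK0 [Abelian C] (S : ObjectProperty C) (n : ℕ) : Type u :=
  SplitK0 S.FullSubcategory ⧸ AddSubgroup.closure
    {r : SplitK0 S.FullSubcategory | ∃ E : ChainComplex S.FullSubcategory ℕ,
      (∀ i, n + 1 < i → IsZero (E.X i)) ∧
      (∀ i, ((S.ι.mapHomologicalComplex _).obj E).ExactAt i) ∧
      r = ∑ i ∈ Finset.range (n + 2), (-1 : ℤ) ^ i • SplitK0.cls (E.X i)}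

instance [Abelian C] (S : ObjectProperty C) (n : ℕ) : AddCommGroup (ExactK0 S n) :=
  inferInstanceAs (AddCommGroup (SplitK0 S.FullSubcategory ⧸ AddSubgroup.closure _))

/-- The class `[X]_S` of an object of `S` in the Grothendieck group of `S`. -/
def ExactK0.cls [Abelian C] {S : ObjectProperty C} (n : ℕ) (X : S.FullSubcategory) :
    ExactK0 S n :=
  QuotientAddGroup.mk (SplitK0.cls X)

end Grothendieck

end

/-! The proof has two independent halves, joined by the inclusion of the projectives in $\mathcal
C^0$ and by $\operatorname{gl.dim}\Lambda\le n$.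

Projectives lie in $\mathcal C^0$. Since $\nu$ and $\nu^{-1}$ are mutually adjoint,
$\operatorname{Hom}(\nu_n^i\Lambda,\Lambda[j])$ vanishes as soon as
$\operatorname{Hom}(\Lambda,\nu_n^{-i}\Lambda[j])=H^j(\nu_n^{-i}\Lambda)$ does, which is the
hypothesis for $n\nmid j$ (`homVanishes_nuPow_regular`). Direct summands extend this to all of
$\mathcal U$ and to all projectives. As `nu` and `nuInv` exist only on objects, adjunction is used
only as transfer of vanishing (`HomVanishes.nu_left`, `HomVanishes.nuInv_left`). Bounded projective
or injective models turn vanishing in the derived category into null-homotopy of chain maps.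
Null-homotopies then move across the module-level unit and counit, which are isomorphisms on
projectives and on injectives respectively.

Comparison of Grothendieck groups. This works for any subcategory `S` containing the projectives of
an abelian category with enough projectives in which all projective dimensions are at most $n$.
Euler characteristics of exact sequences vanish in $K_0$, so $[X]_S\mapsto[X]$ is well defined
(`ExactK0.toK0`). Backwards, $X$ goes to the alternating sum over a projective resolution. Its
additivity (`resolutionClassAdditive`) uses only that short exact sequences of projectives split,
hence hold in the split Grothendieck group of `S`. The maps are mutually inverse because an
augmented resolution of length $n$ of an object of `S` has $n+2$ terms in `S` and is itself a
defining relation (`ExactK0.cls_eq_sum`). -/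

/-! ### Null-homotopies across a unit and a counit -/

section HomotopyTransfer

open HomologicalComplex

variable {C : Type*} [Category* C] [Abelian C]

/-- A natural transformation `H ⟶ 𝟭 C` induces a morphism of complexes `H(K) ⟶ K`. -/
def HomologicalComplex.appOfToId (H : C ⥤ C) [H.Additive] (τ : H ⟶ 𝟭 C)
    (K : CochainComplex C ℤ) : (H.mapHomologicalComplex (.up ℤ)).obj K ⟶ K where
  f i := τ.app (K.X i)
  comm' i j _ := (τ.naturality (K.d i j)).symm

/-- A natural transformation `𝟭 C ⟶ H` induces a morphism of complexes `K ⟶ H(K)`. -/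
def HomologicalComplex.appOfFromId (H : C ⥤ C) [H.Additive] (τ : 𝟭 C ⟶ H)
    (K : CochainComplex C ℤ) : K ⟶ (H.mapHomologicalComplex (.up ℤ)).obj K where
  f i := τ.app (K.X i)
  comm' i j _ := (τ.naturality (K.d i j)).symm

variable {K L : CochainComplex C ℤ}

lemma nonempty_homotopy_zero_of_isIso_comp {K' : CochainComplex C ℤ} (e : K' ⟶ K) [IsIso e]
    (g : K ⟶ L) (h : Nonempty (Homotopy (e ≫ g) 0)) : Nonempty (Homotopy g 0) :=
  h.map fun h => ((Homotopy.ofEq (by simp)).trans (h.compLeft (inv e))).trans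
    (Homotopy.ofEq (by simp))

lemma nonempty_homotopy_zero_of_comp_isIso {L' : CochainComplex C ℤ} (e : L ⟶ L') [IsIso e]
    (g : K ⟶ L) (h : Nonempty (Homotopy (g ≫ e) 0)) : Nonempty (Homotopy g 0) :=
  h.map fun h => ((Homotopy.ofEq (by simp)).trans (h.compRight (inv e))).trans
    (Homotopy.ofEq (by simp))

lemma nonempty_homotopy_zero_map (F : C ⥤ C) [F.Additive] (g : K ⟶ L)
    (h : Nonempty (Homotopy g 0)) :
    Nonempty (Homotopy ((F.mapHomologicalComplex (.up ℤ)).map g) 0) :=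
  h.map fun h => (F.mapHomotopy h).trans (Homotopy.ofEq (by simp))

/-- Naturality gives $\tau_K\circ$-then-$g$ equal to $H(g)$ followed by $\tau_L$; only $\tau_K$ has
to be cancelled, so nothing is asked of $L$. -/
lemma nonempty_homotopy_zero_of_map_of_toId (H : C ⥤ C) [H.Additive] (τ : H ⟶ 𝟭 C) (g : K ⟶ L)
    (hK : ∀ i, IsIso (τ.app (K.X i)))
    (h : Nonempty (Homotopy ((H.mapHomologicalComplex (.up ℤ)).map g) 0)) :
    Nonempty (Homotopy g 0) := by
  have : ∀ i, IsIso ((appOfToId H τ K).f i) := hK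
  have := HomologicalComplex.Hom.isIso_of_components (appOfToId H τ K)
  refine nonempty_homotopy_zero_of_isIso_comp (appOfToId H τ K) g (h.map fun h => ?_)
  exact (Homotopy.ofEq (by ext i; exact (τ.naturality (g.f i)).symm)).trans
    ((h.compRight (appOfToId H τ L)).trans (Homotopy.ofEq (by simp)))

lemma nonempty_homotopy_zero_of_map_of_fromId (H : C ⥤ C) [H.Additive] (τ : 𝟭 C ⟶ H) (g : K ⟶ L)
    (hL : ∀ i, IsIso (τ.app (L.X i)))
    (h : Nonempty (Homotopy ((H.mapHomologicalComplex (.up ℤ)).map g) 0)) :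
    Nonempty (Homotopy g 0) := by
  have : ∀ i, IsIso ((appOfFromId H τ L).f i) := hL
  have := HomologicalComplex.Hom.isIso_of_components (appOfFromId H τ L)
  refine nonempty_homotopy_zero_of_comp_isIso (appOfFromId H τ L) g (h.map fun h => ?_)
  exact (Homotopy.ofEq (by ext i; exact (τ.naturality (g.f i)))).trans
    ((h.compLeft (appOfFromId H τ K)).trans (Homotopy.ofEq (by simp)))

variable (F G : C ⥤ C) [F.Additive] [G.Additive]

/-- One half of an adjunction, reduced to vanishing so that no triangle identity is needed. The
composite of $\eta_K$ and $G(g)$ is null-homotopic; cancelling $\eta_K$ and applying $F$ makes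
$FG(g)$ null-homotopic, and invertibility of $\varepsilon$ on $F(K)$ returns $g$. -/
lemma nonempty_homotopy_zero_of_forall_to_map (η : 𝟭 C ⟶ F ⋙ G) (ε : G ⋙ F ⟶ 𝟭 C)
    (hη : ∀ i, IsIso (η.app (K.X i))) (hε : ∀ i, IsIso (ε.app (F.obj (K.X i))))
    (h : ∀ g : K ⟶ (G.mapHomologicalComplex (.up ℤ)).obj L, Nonempty (Homotopy g 0))
    (g : (F.mapHomologicalComplex (.up ℤ)).obj K ⟶ L) : Nonempty (Homotopy g 0) := by
  have : ∀ i, IsIso ((appOfFromId (F ⋙ G) η K).f i) := hη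
  have := HomologicalComplex.Hom.isIso_of_components (appOfFromId (F ⋙ G) η K)
  refine nonempty_homotopy_zero_of_map_of_toId (G ⋙ F) ε g hε ?_
  exact nonempty_homotopy_zero_map F _ (nonempty_homotopy_zero_of_isIso_comp
    (appOfFromId (F ⋙ G) η K) ((G.mapHomologicalComplex (.up ℤ)).map g) (h _))

/-- The other direction: $F(g)$ preceded by $\varepsilon_K^{-1}$ is null-homotopic, hence so is
$GF(g)$, and $\eta$ is invertible on $L$. -/
lemma nonempty_homotopy_zero_of_forall_from_map (η : 𝟭 C ⟶ F ⋙ G) (ε : G ⋙ F ⟶ 𝟭 C)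
    (hη : ∀ i, IsIso (η.app (L.X i))) (hε : ∀ i, IsIso (ε.app (K.X i)))
    (h : ∀ g : K ⟶ (F.mapHomologicalComplex (.up ℤ)).obj L, Nonempty (Homotopy g 0))
    (g : (G.mapHomologicalComplex (.up ℤ)).obj K ⟶ L) : Nonempty (Homotopy g 0) := by
  have : ∀ i, IsIso ((appOfToId (G ⋙ F) ε K).f i) := hε
  have := HomologicalComplex.Hom.isIso_of_components (appOfToId (G ⋙ F) ε K)
  refine nonempty_homotopy_zero_of_map_of_fromId (F ⋙ G) η g hη ?_
  refine nonempty_homotopy_zero_map G ((F.mapHomologicalComplex (.up ℤ)).map g) ?_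
  have := h (inv (appOfToId (G ⋙ F) ε K) ≫ (F.mapHomologicalComplex (.up ℤ)).map g)
  exact nonempty_homotopy_zero_of_isIso_comp (inv (appOfToId (G ⋙ F) ε K))
    ((F.mapHomologicalComplex (.up ℤ)).map g) this

end HomotopyTransfer

/-! ### Vanishing of Hom in the derived category -/

section DerivedHom

open DerivedCategory

variable {C : Type*} [Category* C] [Abelian C] [HasDerivedCategory C] {K L : CochainComplex C ℤ}

lemma Q_map_surjective_of_Qh_map_bijective
    (h : Function.Bijective (Qh.map : ((HomotopyCategory.quotient _ _).obj K ⟶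
        (HomotopyCategory.quotient _ _).obj L) → _)) :
    Function.Surjective (Q.map : (K ⟶ L) → (Q.obj K ⟶ Q.obj L)) := fun f => by
  obtain ⟨g, hg⟩ := h.surjective
    ((quotientCompQhIso C).hom.app K ≫ f ≫ (quotientCompQhIso C).inv.app L)
  obtain ⟨g, rfl⟩ := (HomotopyCategory.quotient C (.up ℤ)).map_surjective g
  refine ⟨g, ?_⟩
  rw [← cancel_epi ((quotientCompQhIso C).hom.app K), ← quotientCompQhIso_hom_naturality, hg]
  simp

lemma nonempty_homotopy_zero_of_Q_map_eq_zero
    (h : Function.Bijective (Qh.map : ((HomotopyCategory.quotient _ _).obj K ⟶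
        (HomotopyCategory.quotient _ _).obj L) → _)) (f : K ⟶ L) (hf : Q.map f = 0) :
    Nonempty (Homotopy f 0) := by
  refine ⟨HomotopyCategory.homotopyOfEq _ _ (h.injective ?_)⟩
  have := quotientCompQhIso_hom_naturality f
  rw [hf, comp_zero] at this
  simpa using (cancel_mono ((quotientCompQhIso C).hom.app L)).1 (this.trans zero_comp.symm)

lemma Q_map_eq_zero_of_homotopy (f : K ⟶ L) (h : Homotopy f 0) : Q.map f = 0 := by
  have := quotientCompQhIso_hom_naturality f
  rw [HomotopyCategory.eq_of_homotopy _ _ h] at this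
  rw [← cancel_epi ((quotientCompQhIso C).hom.app K), ← this]
  simp

/-- All morphisms `X ⟶ Y` are zero. -/
def HomVanishes {D : Type*} [Category* D] [HasZeroMorphisms D] (X Y : D) : Prop :=
  ∀ f : X ⟶ Y, f = 0

lemma HomVanishes.of_iso {D : Type*} [Category* D] [HasZeroMorphisms D] {X Y X' Y' : D}
    (h : HomVanishes X Y) (e : X ≅ X') (e' : Y ≅ Y') : HomVanishes X' Y' := fun f => by
  have := h (e.hom ≫ f ≫ e'.inv)
  rw [← cancel_epi e.hom, ← cancel_mono e'.inv]
  simpa using this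

lemma HomVanishes.shift {D : Type*} [Category* D] [Preadditive D] [HasShift D ℤ]
    [∀ n : ℤ, (shiftFunctor D n).Additive]
    {X Y : D} (h : HomVanishes X Y) (n : ℤ) : HomVanishes (X⟦n⟧) (Y⟦n⟧) := fun f => by
  obtain ⟨g, rfl⟩ := (shiftFunctor D n).map_surjective f
  rw [h g, Functor.map_zero]

/-- The bridge to chain level: the hypothesis holds when `K` is K-projective or `L` is K-injective.
-/
lemma homVanishes_Q_obj_iff
    (h : Function.Bijective (Qh.map : ((HomotopyCategory.quotient _ _).obj K ⟶
        (HomotopyCategory.quotient _ _).obj L) → _)) :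
    HomVanishes (Q.obj K) (Q.obj L) ↔ ∀ g : K ⟶ L, Nonempty (Homotopy g 0) := by
  refine ⟨fun H g => nonempty_homotopy_zero_of_Q_map_eq_zero h g (H _), fun H f => ?_⟩
  obtain ⟨g, rfl⟩ := Q_map_surjective_of_Qh_map_bijective h f
  exact Q_map_eq_zero_of_homotopy g (H g).some

-- A map from a projective stalk to a complex is a map from $P$ into the degree $0$ cycles.
-- Exactness in degree $0$ and projectivity lift it to degree $-1$, and this lift is the
-- null-homotopy.
open CochainComplex.HomComplex in
lemma homVanishes_singleFunctor_of_isZero_homology (P : C) [Projective P] (X : DerivedCategory C)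
    (hX : IsZero ((homologyFunctor C 0).obj X)) : HomVanishes ((singleFunctor C 0).obj P) X := by
  let K := Q.objPreimage X
  let e : Q.obj K ≅ X := Q.objObjPreimageIso X
  let S : CochainComplex C ℤ := (CochainComplex.singleFunctor C 0).obj P
  have hS : ∀ i, Projective (S.X i) := fun i => by
    by_cases hi : i = 0
    · subst hi
      exact Projective.of_iso (HomologicalComplex.singleObjXSelf (.up ℤ) 0 P).symm inferInstance
    · exact (HomologicalComplex.isZero_single_obj_X (.up ℤ) 0 P i hi).projective
  have : S.IsStrictlyLE 0 :=
    inferInstanceAs (CochainComplex.IsStrictlyLE ((HomologicalComplex.single C (.up ℤ) 0).obj P) 0)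
  have := CochainComplex.isKProjective_of_projective S 0
  have hK : K.ExactAt 0 := by
    rw [HomologicalComplex.exactAt_iff_isZero_homology]
    exact hX.of_iso ((homologyFunctorFactors C 0).symm.app K ≪≫
      (homologyFunctor C 0).mapIso e)
  suffices HomVanishes (Q.obj S) (Q.obj K) from this.of_iso (Iso.refl _) e
  rw [homVanishes_Q_obj_iff (CochainComplex.IsKProjective.Qh_map_bijective _ _)]
  intro g
  obtain ⟨p, hp⟩ := Cochain.fromSingleMk_surjective (Cochain.ofHom g) 0 (by simp)
  -- The cocycle condition $\delta(g)=0$, read off on the single component of $g$.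
  have hp' : p ≫ K.d 0 1 = 0 := by
    have := δ_ofHom (p := 1) g
    rw [← hp, Cochain.δ_fromSingleMk _ _ _ 1 (by simp)] at this
    have h2 := congrArg (Cochain.fromSingleEquiv (X := P) (K := K) (p := 0) (q := 1) (n := 1)
      (by simp)) this
    simpa using h2
  have hK' := (K.exactAt_iff' (-1) 0 1 (by simp) (by simp)).1 hK
  obtain ⟨q, hq⟩ : ∃ q : P ⟶ K.X (-1), q ≫ K.d (-1) 0 = p :=
    ⟨hK'.liftFromProjective p hp', hK'.liftFromProjective_comp p hp'⟩
  refine ⟨(Cochain.equivHomotopy _ _).symm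
    ⟨Cochain.fromSingleMk q (n := -1) (by simp), ?_⟩⟩
  rw [Cochain.δ_fromSingleMk _ _ _ 0 (by simp), hq, ← hp]
  simp

end DerivedHom

/-! ### Bounded projective and injective models -/

section BoundedModels

open DerivedCategory

variable {C : Type*} [Category* C] [Abelian C]

/-- `K` is a bounded complex whose terms satisfy `R`. -/
structure IsBoundedComplexIn (R : ObjectProperty C) (K : CochainComplex C ℤ) : Prop where
  bounded : ∃ a b : ℤ, K.IsStrictlyGE a ∧ K.IsStrictlyLE b
  prop : ∀ i, R (K.X i)

variable (R : ObjectProperty C)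

lemma isBoundedComplexIn_of_isZero_outside [R.ContainsZero] [R.IsClosedUnderIsomorphisms]
    {K : CochainComplex C ℤ} (a : ℤ) (hK : ∀ i ≠ a, IsZero (K.X i)) (ha : R (K.X a)) :
    IsBoundedComplexIn R K where
  bounded := ⟨a, a, (K.isStrictlyGE_iff a).2 fun i _ => hK i (by lia),
    (K.isStrictlyLE_iff a).2 fun i _ => hK i (by lia)⟩
  prop i := by
    by_cases hi : i = a
    · exact hi ▸ ha
    · exact R.prop_of_isZero (hK i hi)

variable {R}

lemma IsBoundedComplexIn.shift [R.IsClosedUnderIsomorphisms] {K : CochainComplex C ℤ}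
    (hK : IsBoundedComplexIn R K) (n : ℤ) : IsBoundedComplexIn R (K⟦n⟧) where
  bounded := by
    obtain ⟨a, b, _, _⟩ := hK.bounded
    exact ⟨a - n, b - n, K.isStrictlyGE_shift a n _ (by lia),
      K.isStrictlyLE_shift b n _ (by lia)⟩
  prop i := hK.prop (i + n)

lemma IsBoundedComplexIn.mappingCone [R.IsClosedUnderIsomorphisms] {K L : CochainComplex C ℤ}
    (hR : ∀ X Y, R X → R Y → R (X ⊞ Y)) (hK : IsBoundedComplexIn R K)
    (hL : IsBoundedComplexIn R L) (f : K ⟶ L) :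
    IsBoundedComplexIn R (CochainComplex.mappingCone f) where
  bounded := by
    obtain ⟨a, b, _, _⟩ := hK.bounded
    obtain ⟨a', b', _, _⟩ := hL.bounded
    refine ⟨min (a - 1) a', max b b', ?_, ?_⟩
    · rw [CochainComplex.isStrictlyGE_iff]
      intro i hi
      rw [CochainComplex.mappingCone.isZero_X_iff]
      exact ⟨K.isZero_of_isStrictlyGE a _ (by lia), L.isZero_of_isStrictlyGE a' _ (by lia)⟩
    · rw [CochainComplex.isStrictlyLE_iff]
      intro i hi
      rw [CochainComplex.mappingCone.isZero_X_iff]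
      exact ⟨K.isZero_of_isStrictlyLE b _ (by lia), L.isZero_of_isStrictlyLE b' _ (by lia)⟩
  prop i := R.prop_of_iso (HomologicalComplex.homotopyCofiber.XIsoBiprod f i (i + 1) rfl).symm
    (hR _ _ (hK.prop (i + 1)) (hL.prop i))

lemma IsBoundedComplexIn.map {F : C ⥤ C} [F.Additive] {R' : ObjectProperty C}
    {K : CochainComplex C ℤ} (hK : IsBoundedComplexIn R K)
    (hF : ∀ X, R X → R' (F.obj X)) :
    IsBoundedComplexIn R' ((F.mapHomologicalComplex _).obj K) where
  bounded := by
    obtain ⟨a, b, _, _⟩ := hK.bounded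
    exact ⟨a, b, (CochainComplex.isStrictlyGE_iff _ a).2 fun i _ =>
        F.map_isZero (K.isZero_of_isStrictlyGE a i),
      (CochainComplex.isStrictlyLE_iff _ b).2 fun i _ =>
        F.map_isZero (K.isZero_of_isStrictlyLE b i)⟩
  prop i := hF _ (hK.prop i)

lemma IsBoundedComplexIn.isKProjective {K : CochainComplex C ℤ}
    (hK : IsBoundedComplexIn (isProjective C) K) : K.IsKProjective := by
  obtain ⟨_, b, _, _⟩ := hK.bounded
  have : ∀ i, Projective (K.X i) := hK.prop
  exact CochainComplex.isKProjective_of_projective K b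

lemma IsBoundedComplexIn.isKInjective {K : CochainComplex C ℤ}
    (hK : IsBoundedComplexIn (isInjective C) K) : K.IsKInjective := by
  obtain ⟨a, _, _, _⟩ := hK.bounded
  have : ∀ i, Injective (K.X i) := hK.prop
  exact CochainComplex.isKInjective_of_injective K a

/-- Both bounds express the vanishing of $\operatorname{Ext}^i$ for $i>n$, in one variable or the
other. -/
lemma hasInjectiveDimensionLE_of_forall (n : ℕ) (h : ∀ X : C, HasProjectiveDimensionLE X n)
    (X : C) : HasInjectiveDimensionLE X n := by
  have := HasExt.standard C
  rw [HasInjectiveDimensionLE, hasInjectiveDimensionLT_iff]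
  intro i hi Y e
  have := h Y
  exact e.eq_zero_of_hasProjectiveDimensionLT (n + 1) hi

variable [HasDerivedCategory C]

lemma IsBoundedComplexIn.bounded_Q_obj {K : CochainComplex C ℤ}
    (hK : IsBoundedComplexIn R K) : TStructure.t.bounded (Q.obj K) := by
  obtain ⟨a, b, _, _⟩ := hK.bounded
  exact ⟨⟨a, ⟨K, Iso.refl _, inferInstance⟩⟩, ⟨b, ⟨K, Iso.refl _, inferInstance⟩⟩⟩

variable (R) in
/-- The objects of the derived category isomorphic to a bounded complex with terms in `R`. -/
def hasBoundedModel : ObjectProperty (DerivedCategory C) := fun X =>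
  ∃ K, IsBoundedComplexIn R K ∧ Nonempty (Q.obj K ≅ X)

instance : (hasBoundedModel R).IsClosedUnderIsomorphisms where
  of_iso := by
    rintro X Y e ⟨K, hK, ⟨e'⟩⟩
    exact ⟨K, hK, ⟨e' ≪≫ e⟩⟩

lemma hasBoundedModel_singleFunctor [R.ContainsZero] [R.IsClosedUnderIsomorphisms] {M : C}
    (hM : R M) : hasBoundedModel R ((singleFunctor C 0).obj M) :=
  ⟨(HomologicalComplex.single C (.up ℤ) 0).obj M,
    isBoundedComplexIn_of_isZero_outside R 0
      (fun i hi => HomologicalComplex.isZero_single_obj_X (.up ℤ) 0 M i hi)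
      (R.prop_of_iso (HomologicalComplex.singleObjXSelf (.up ℤ) 0 M).symm hM), ⟨Iso.refl _⟩⟩

/-- By `hQ`, a morphism between modelled objects comes from a chain map, whose mapping cone models
the third vertex of the triangle. -/
lemma hasBoundedModel_isTriangulated [R.ContainsZero] [R.IsClosedUnderIsomorphisms]
    (hR : ∀ X Y, R X → R Y → R (X ⊞ Y))
    (hQ : ∀ K L, IsBoundedComplexIn R K → IsBoundedComplexIn R L →
      Function.Surjective (Q.map : (K ⟶ L) → (Q.obj K ⟶ Q.obj L))) :
    (hasBoundedModel R).IsTriangulated := by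
  have h0 : (hasBoundedModel R).ContainsZero := by
    obtain ⟨Z, hZ, hRZ⟩ := R.exists_prop_of_containsZero
    exact ⟨_, (singleFunctor C 0).map_isZero hZ, hasBoundedModel_singleFunctor hRZ⟩
  have hs : (hasBoundedModel R).IsStableUnderShift ℤ :=
    { isStableUnderShiftBy := fun n =>
        { le_shift := by
            rintro X ⟨K, hK, ⟨e⟩⟩
            exact ⟨K⟦n⟧, hK.shift n, ⟨(Q.commShiftIso n).app K ≪≫
              (shiftFunctor (DerivedCategory C) n).mapIso e⟩⟩ } }
  have h3 : (hasBoundedModel R).IsTriangulatedClosed₃ := .mk' (by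
    rintro T hT ⟨K, hK, ⟨e⟩⟩ ⟨L, hL, ⟨e'⟩⟩
    obtain ⟨f, hf⟩ := hQ K L hK hL (e.hom ≫ T.mor₁ ≫ e'.inv)
    obtain ⟨i, -⟩ := Pretriangulated.exists_iso_of_arrow_iso _ _
      (mappingCone_triangle_distinguished f) hT (Arrow.isoMk e e' (by
        change e.hom ≫ T.mor₁ = Q.map f ≫ e'.hom
        simp [hf]))
    exact ⟨CochainComplex.mappingCone f, hK.mappingCone hR hL f,
      ⟨Pretriangulated.Triangle.π₃.mapIso i⟩⟩)
  have := ObjectProperty.IsTriangulatedClosed₂.of_isTriangulatedClosed₃ (P := hasBoundedModel R)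
  constructor

/-- A triangulated subcategory containing the stalk complexes contains all bounded objects. -/
lemma prop_of_bounded (S : ObjectProperty (DerivedCategory C)) [S.IsTriangulated]
    [S.IsClosedUnderIsomorphisms] (h : ∀ M, S ((singleFunctor C 0).obj M))
    (X : DerivedCategory C) (hX : TStructure.t.bounded X) : S X := by
  obtain ⟨⟨a, ha⟩, ⟨b, hb⟩⟩ := hX
  -- Induction on the amplitude: `d` bounds the number of degrees that can carry cohomology.
  have key : ∀ (d : ℕ) (a b : ℤ), b - a < d → ∀ X : DerivedCategory C, X.IsGE a → X.IsLE b →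
      S X := by
    intro d
    induction d with
    | zero =>
      intro a b hab X _ _
      exact S.prop_of_isZero (TStructure.t.isZero X b a (by lia))
    | succ d ih =>
      intro a b hab X _ _
      -- Split off the top degree $b$: what remains has smaller amplitude, and the split-off part is
      -- a shifted stalk.
      refine S.ext_of_isTriangulatedClosed₂ _ (TStructure.t.triangleLTGE_distinguished b X) ?_ ?_
      · exact ih a (b - 1) (by lia) _
          (inferInstanceAs (TStructure.t.IsGE ((TStructure.t.truncLT b).obj X) a))
          (inferInstanceAs (TStructure.t.IsLE ((TStructure.t.truncLT b).obj X) (b - 1)))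
      · have h1 : ((TStructure.t.truncGE b).obj X).IsGE b := inferInstance
        have h2 : ((TStructure.t.truncGE b).obj X).IsLE b := inferInstance
        obtain ⟨M, ⟨e⟩⟩ := exists_iso_singleFunctor_obj_of_isGE_of_isLE
          ((TStructure.t.truncGE b).obj X) b
        refine S.prop_of_iso (?_ ≪≫ e.symm) (S.le_shift (-b) _ (h M))
        exact ((singleFunctors C).shiftIso (-b) b 0 (by lia)).app M
  exact key (b - a + 1).toNat a b (by lia) X ha hb

instance : (isProjective C).ContainsZero where
  exists_zero := ⟨0, isZero_zero C, (isZero_zero C).projective⟩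

instance : (isProjective C).IsClosedUnderIsomorphisms where
  of_iso e h := Projective.of_iso e h

instance : (isInjective C).IsClosedUnderIsomorphisms where
  of_iso e h := Injective.of_iso e h

instance : (hasBoundedModel (isProjective C)).IsTriangulated :=
  hasBoundedModel_isTriangulated (fun _ _ _ _ => inferInstance) fun K L hK _ => by
    have := hK.isKProjective
    exact Q_map_surjective_of_Qh_map_bijective
      (CochainComplex.IsKProjective.Qh_map_bijective _ _)

instance : (hasBoundedModel (isInjective C)).IsTriangulated :=
  hasBoundedModel_isTriangulated (fun _ _ _ _ => inferInstance) fun K L _ hL => by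
    have := hL.isKInjective
    exact Q_map_surjective_of_Qh_map_bijective
      (CochainComplex.IsKInjective.Qh_map_bijective _ _)

/-- Dimension shifting: the syzygy and the projective above it have models, and the object is the
third vertex of their triangle. -/
lemma hasBoundedModel_isProjective_singleFunctor [EnoughProjectives C] (n : ℕ) (M : C)
    (hM : HasProjectiveDimensionLE M n) :
    hasBoundedModel (isProjective C) ((singleFunctor C 0).obj M) := by
  induction n generalizing M with
  | zero =>
    exact hasBoundedModel_singleFunctor ((projective_iff_hasProjectiveDimensionLE_zero M).2 hM)
  | succ n ih =>
    let S : ShortComplex C := .mk (kernel.ι (Projective.π M)) (Projective.π M) (by simp)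
    have hS : S.ShortExact := { exact := S.exact_of_f_is_kernel (kernelIsKernel _) }
    have h1 := (hS.hasProjectiveDimensionLT_X₃_iff n (inferInstanceAs (Projective
      (Projective.over M)))).1 hM
    exact ObjectProperty.ext_of_isTriangulatedClosed₃ _ _ hS.singleTriangle_distinguished
      (ih _ h1) (hasBoundedModel_singleFunctor (Projective.projective_over M))

lemma hasBoundedModel_isInjective_singleFunctor [EnoughInjectives C] (n : ℕ) (M : C)
    (hM : HasInjectiveDimensionLE M n) :
    hasBoundedModel (isInjective C) ((singleFunctor C 0).obj M) := by
  induction n generalizing M with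
  | zero => exact hasBoundedModel_singleFunctor ((injective_iff_hasInjectiveDimensionLT_one).2 hM)
  | succ n ih =>
    let S : ShortComplex C := .mk (Injective.ι M) (cokernel.π (Injective.ι M)) (by simp)
    have hS : S.ShortExact := { exact := S.exact_of_g_is_cokernel (cokernelIsCokernel _) }
    have h1 := (hS.hasInjectiveDimensionLT_X₃_iff n (inferInstanceAs (Injective
      (Injective.under M)))).2 hM
    exact ObjectProperty.ext_of_isTriangulatedClosed₁ _ _ hS.singleTriangle_distinguished
      (hasBoundedModel_singleFunctor (Injective.injective_under M)) (ih _ h1)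

lemma hasBoundedModel_isProjective_of_bounded [EnoughProjectives C] (n : ℕ)
    (h : ∀ X : C, HasProjectiveDimensionLE X n) (X : DerivedCategory C)
    (hX : TStructure.t.bounded X) : hasBoundedModel (isProjective C) X :=
  prop_of_bounded _ (fun M => hasBoundedModel_isProjective_singleFunctor n M (h M)) X hX

lemma hasBoundedModel_isInjective_of_bounded [EnoughInjectives C] (n : ℕ)
    (h : ∀ X : C, HasProjectiveDimensionLE X n) (X : DerivedCategory C)
    (hX : TStructure.t.bounded X) : hasBoundedModel (isInjective C) X :=
  prop_of_bounded _ (fun M => hasBoundedModel_isInjective_singleFunctor n M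
    (hasInjectiveDimensionLE_of_forall n h M)) X hX

end BoundedModels

/-! ### Additivity of the class of a projective resolution -/

section ResolutionClass

variable {C : Type*} [Category* C] [Abelian C]

/-- Pulling back an epimorphism preserves it and does not change its kernel. -/
lemma CategoryTheory.ShortComplex.ShortExact.of_isPullback {S : ShortComplex C} (hS : S.ShortExact)
    {W Y : C} {p : W ⟶ S.X₂} {q : W ⟶ Y} {g : Y ⟶ S.X₃} (h : IsPullback p q S.g g) :
    ∃ (i : S.X₁ ⟶ W) (w : i ≫ q = 0), (ShortComplex.mk i q w).ShortExact := by
  have := hS.mono_f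
  have := hS.epi_g
  have : Epi q := by
    have := h.isoPullback_hom_snd
    rw [← this]
    infer_instance
  have hw : S.f ≫ S.g = 0 ≫ g := by simp
  have hi : h.lift S.f 0 hw ≫ p = S.f := h.lift_fst _ _ _
  have : Mono (h.lift S.f 0 hw) := by
    have : Mono (h.lift S.f 0 hw ≫ p) := by rw [hi]; infer_instance
    exact mono_of_mono _ p
  refine ⟨h.lift S.f 0 hw, h.lift_snd _ _ _, { exact := ?_ }⟩
  refine ShortComplex.exact_of_f_is_kernel _ (KernelFork.IsLimit.ofι' _ _ fun {T} k hk => ?_)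
  have hk' : (k ≫ p) ≫ S.g = 0 := by rw [Category.assoc, h.w, ← Category.assoc, hk, zero_comp]
  refine ⟨hS.exact.lift (k ≫ p) hk', h.hom_ext ?_ ?_⟩
  · rw [Category.assoc, hi, hS.exact.lift_f]
  · rw [Category.assoc, h.lift_snd, comp_zero, hk]

/-- For `f : X ⟶ Y` mono with cokernel `Z` and `π : Q ⟶ Y` epi, the pullback of `π` along `f` is the
kernel of `Q ⟶ Z`. -/
lemma CategoryTheory.ShortComplex.ShortExact.of_isPullback_left {S : ShortComplex C}
    (hS : S.ShortExact) {B Q : C} {p : B ⟶ Q} {q : B ⟶ S.X₁} {π : Q ⟶ S.X₂} [Epi π]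
    (h : IsPullback p q π S.f) :
    ∃ w : p ≫ π ≫ S.g = 0, (ShortComplex.mk p (π ≫ S.g) w).ShortExact := by
  have := hS.mono_f
  have := hS.epi_g
  have : Mono p := by
    rw [← h.isoPullback_hom_fst]
    infer_instance
  have hw : p ≫ π ≫ S.g = 0 := by rw [h.w_assoc, S.zero, comp_zero]
  refine ⟨hw, { exact := ?_, epi_g := epi_comp _ _ }⟩
  refine ShortComplex.exact_of_f_is_kernel _ (KernelFork.IsLimit.ofι' _ _ fun {T} k hk => ?_)
  have hk' : (k ≫ π) ≫ S.g = 0 := by simpa using hk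
  exact ⟨h.lift k (hS.exact.lift (k ≫ π) hk') (hS.exact.lift_f _ _).symm, h.lift_fst _ _ _⟩

variable [EnoughProjectives C] {A : Type*} [AddCommGroup A] (φ : C → A)

/-- The alternating sum of `φ` over a projective resolution, truncated at the `k`-th syzygy. -/
noncomputable def resolutionClass : ℕ → C → A
  | 0, X => φ X
  | k + 1, X => φ (Projective.over X) - resolutionClass k (kernel (Projective.π X))

lemma kernelProjectiveπ_shortExact (X : C) :
    (ShortComplex.mk (kernel.ι (Projective.π X)) (Projective.π X) (by simp)).ShortExact where
  exact := ShortComplex.exact_of_f_is_kernel _ (kernelIsKernel _)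

variable {φ}

/-- `φ` is additive on short exact sequences of projective objects. -/
def IsAdditiveOnProjectives (φ : C → A) : Prop :=
  ∀ S : ShortComplex C, S.ShortExact → Projective S.X₁ → Projective S.X₂ → Projective S.X₃ →
    φ S.X₂ = φ S.X₁ + φ S.X₃

/-- The syzygy of a projective splits off and is again projective, so the alternating sum
telescopes. -/
lemma resolutionClass_of_projective (hφ : IsAdditiveOnProjectives φ) (k : ℕ) (P : C)
    [Projective P] : resolutionClass φ k P = φ P := by
  induction k generalizing P with
  | zero => rfl
  | succ k ih =>
    have hS := kernelProjectiveπ_shortExact P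
    have : Projective (kernel (Projective.π P)) := Retract.projective
      ⟨kernel.ι (Projective.π P), hS.splittingOfProjective.r, hS.splittingOfProjective.f_r⟩
    rw [resolutionClass, ih, hφ _ hS this (Projective.projective_over P) ‹_›, add_sub_cancel_left]

/-- Additivity of the truncated alternating sum on objects of bounded projective dimension. -/
def ResolutionClassAdditive (φ : C → A) (k : ℕ) : Prop :=
  ∀ S : ShortComplex C, S.ShortExact → HasProjectiveDimensionLE S.X₁ k →
    HasProjectiveDimensionLE S.X₂ k → HasProjectiveDimensionLE S.X₃ k →
    resolutionClass φ k S.X₂ = resolutionClass φ k S.X₁ + resolutionClass φ k S.X₃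

/-- Schanuel's argument. With $P\to X_3$ the chosen cover and $\Omega$ its kernel, the pullback $W$
of $X_2\to X_3\leftarrow P$ is an extension of $P$ by $X_1$ and of $X_2$ by $\Omega$. Additivity at
level $k$ on both sequences gives $[P]-[\Omega]=[X_2]-[X_1]$, so any presentation of $X_3$ by
objects of dimension at most $k$ computes its class. -/
lemma resolutionClass_succ_X₃ (hφ : IsAdditiveOnProjectives φ) {k : ℕ}
    (hk : ResolutionClassAdditive φ k) {S : ShortComplex C} (hS : S.ShortExact)
    (h₁ : HasProjectiveDimensionLE S.X₁ k) (h₂ : HasProjectiveDimensionLE S.X₂ k) :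
    resolutionClass φ (k + 1) S.X₃ = resolutionClass φ k S.X₂ - resolutionClass φ k S.X₁ := by
  have h₃ : HasProjectiveDimensionLE S.X₃ (k + 1) :=
    hS.hasProjectiveDimensionLT_X₃ (k + 1) h₁ (hasProjectiveDimensionLT_of_ge _ (k + 1) _ (by lia))
  have hT := kernelProjectiveπ_shortExact S.X₃
  have hΩ : HasProjectiveDimensionLE (kernel (Projective.π S.X₃)) k :=
    (hT.hasProjectiveDimensionLT_X₃_iff k (Projective.projective_over S.X₃)).1 h₃
  have hP : HasProjectiveDimensionLE (Projective.over S.X₃) k :=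
    hasProjectiveDimensionLT_of_ge _ 1 _ (by lia)
  have h := IsPullback.of_hasPullback S.g (Projective.π S.X₃)
  obtain ⟨i, wi, hi⟩ := hS.of_isPullback h
  obtain ⟨j, wj, hj⟩ := hT.of_isPullback h.flip
  have hW : HasProjectiveDimensionLE (pullback S.g (Projective.π S.X₃)) k :=
    hi.hasProjectiveDimensionLT_X₂ (k + 1) h₁ hP
  have e₁ := hk _ hi h₁ hW hP
  have e₂ := hk _ hj hΩ hW h₂
  dsimp at e₁ e₂
  rw [resolutionClass_of_projective hφ k (Projective.over S.X₃)] at e₁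
  rw [resolutionClass, sub_eq_sub_iff_add_eq_add, add_comm (φ _), ← e₁, e₂, add_comm]

/-- For the cover $Q\to X_2$ with kernel $\Omega$, let $B$ be the preimage of $X_1$ in $Q$. Then
$X_2=Q/\Omega$, $X_1=B/\Omega$ and $X_3=Q/B$, and $[Q]-[\Omega]=([B]-[\Omega])+([Q]-[B])$. The
previous lemma applies since $B$ and $\Omega$ have dimension at most $k$. -/
lemma resolutionClassAdditive (hφ : IsAdditiveOnProjectives φ) (k : ℕ) :
    ResolutionClassAdditive φ k := by
  induction k with
  | zero =>
    intro S hS h₁ h₂ h₃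
    exact hφ S hS ((projective_iff_hasProjectiveDimensionLE_zero _).2 h₁)
      ((projective_iff_hasProjectiveDimensionLE_zero _).2 h₂)
      ((projective_iff_hasProjectiveDimensionLE_zero _).2 h₃)
  | succ k ih =>
    intro S hS h₁ h₂ h₃
    have hT := kernelProjectiveπ_shortExact S.X₂
    have h := IsPullback.of_hasPullback (Projective.π S.X₂) S.f
    obtain ⟨w, hB⟩ := hS.of_isPullback_left h
    obtain ⟨i, wi, hi⟩ := hT.of_isPullback h
    have hQ : HasProjectiveDimensionLE (Projective.over S.X₂) k :=
      hasProjectiveDimensionLT_of_ge _ 1 _ (by lia)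
    have pB : HasProjectiveDimensionLE (pullback (Projective.π S.X₂) S.f) k :=
      (hB.hasProjectiveDimensionLT_X₃_iff k (Projective.projective_over S.X₂)).1 h₃
    have pΩ : HasProjectiveDimensionLE (kernel (Projective.π S.X₂)) k :=
      (hT.hasProjectiveDimensionLT_X₃_iff k (Projective.projective_over S.X₂)).1 h₂
    have e₃ := resolutionClass_succ_X₃ hφ ih hB pB hQ
    have e₁ := resolutionClass_succ_X₃ hφ ih hi pΩ pB
    dsimp at e₃ e₁
    rw [e₁, e₃, resolutionClass, resolutionClass_of_projective hφ k (Projective.over S.X₂)]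
    abel

end ResolutionClass

/-! ### Euler characteristics of exact complexes -/

section EulerCharacteristic

variable {C : Type*} [Category* C] [Abelian C] {A : Type*} [AddCommGroup A] {χ : C → A}
  (hχ : ∀ S : ShortComplex C, S.ShortExact → χ S.X₂ = χ S.X₁ + χ S.X₃)

include hχ

lemma eq_zero_of_isZero_of_additive {X : C} (hX : IsZero X) : χ X = 0 := by
  have : (ShortComplex.mk (0 : X ⟶ X) (0 : X ⟶ X) (by simp)).ShortExact :=
    { exact := ShortComplex.exact_of_isZero_X₂ _ hX
      mono_f := ⟨fun _ _ _ => hX.eq_of_tgt _ _⟩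
      epi_g := ⟨fun _ _ _ => hX.eq_of_src _ _⟩ }
  simpa using hχ _ this

lemma eq_of_iso_of_additive {X Y : C} (e : X ≅ Y) : χ X = χ Y := by
  have : (ShortComplex.mk e.hom (0 : Y ⟶ 0) (by simp)).ShortExact :=
    { exact := (ShortComplex.exact_iff_epi _ rfl).2 inferInstance
      mono_f := inferInstanceAs (Mono e.hom)
      epi_g := ⟨fun _ _ _ => (isZero_zero C).eq_of_src _ _⟩ }
  have := hχ _ this
  simpa [eq_zero_of_isZero_of_additive hχ (isZero_zero C)] using this.symm

/-- Exactness in degree $m$ makes $0\to Z_{m+1}\to E_{m+1}\to Z_m\to0$ short exact, so the sum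
telescopes to its last cycle object. -/
lemma sum_eq_cycles_of_exactAt (E : ChainComplex C ℕ) (hE : ∀ i, E.ExactAt i) (m : ℕ) :
    ∑ i ∈ Finset.range (m + 1), (-1 : ℤ) ^ i • χ (E.X i) = (-1 : ℤ) ^ m • χ (E.cycles m) := by
  induction m with
  | zero =>
    have : IsIso (E.iCycles 0) := E.isIso_iCycles 0 0 (by simp) (E.shape _ _ (by simp))
    simp [eq_of_iso_of_additive hχ (asIso (E.iCycles 0))]
  | succ m ih =>
    have : Epi (E.toCycles (m + 1) m) := by
      exact Preadditive.epi_of_isZero_cokernel' _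
        (E.homologyIsCokernel (m + 1) m (by simp)) (hE m).isZero_homology
    have hS : (ShortComplex.mk (E.iCycles (m + 1)) (E.toCycles (m + 1) m) (by
        simp [← cancel_mono (E.iCycles m)])).ShortExact :=
      { exact := ShortComplex.exact_of_f_is_kernel _ (KernelFork.IsLimit.ofι' _ _ fun k hk =>
          ⟨E.liftCycles k m (by simp) (by
            rw [← E.toCycles_i, ← Category.assoc, hk, zero_comp]), by simp⟩) }
    rw [Finset.sum_range_succ, ih, hχ _ hS]
    simp [pow_succ]

lemma sum_eq_zero_of_exactAt (E : ChainComplex C ℕ) (hE : ∀ i, E.ExactAt i) (m : ℕ)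
    (h0 : ∀ i, m < i → IsZero (E.X i)) :
    ∑ i ∈ Finset.range (m + 1), (-1 : ℤ) ^ i • χ (E.X i) = 0 := by
  -- One degree beyond $m$, both the term and its cycles are zero.
  have h1 := sum_eq_cycles_of_exactAt hχ E hE (m + 1)
  have h2 : IsZero (E.cycles (m + 1)) :=
    IsZero.of_mono (E.iCycles (m + 1)) (h0 _ (by lia))
  rw [Finset.sum_range_succ, eq_zero_of_isZero_of_additive hχ (h0 (m + 1) (by lia)),
    eq_zero_of_isZero_of_additive hχ h2] at h1
  simpa using h1

end EulerCharacteristic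

/-! ### Projective resolutions of bounded length -/

section Resolutions

variable {C : Type*} [Category* C] [Abelian C]

lemma augment_exactAt (K : ChainComplex C ℕ) {X : C} (f : K.X 0 ⟶ X) (w : K.d 1 0 ≫ f = 0)
    [Epi f] (h0 : (ShortComplex.mk _ _ w).Exact) (hs : ∀ n, K.ExactAt (n + 1)) (n : ℕ) :
    (K.augment f w).ExactAt n := by
  match n with
  | 0 =>
    rw [HomologicalComplex.exactAt_iff' _ 1 0 0 (by simp) (by simp)]
    exact (ShortComplex.exact_iff_epi _ ((K.augment f w).shape 0 0 (by simp))).2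
      (inferInstanceAs (Epi f))
  | 1 =>
    rw [HomologicalComplex.exactAt_iff' _ 2 1 0 (by simp) (by simp)]
    exact h0
  | n + 2 =>
    rw [HomologicalComplex.exactAt_iff' _ (n + 3) (n + 2) (n + 1) (by simp) (by simp)]
    exact (K.exactAt_iff' (n + 2) (n + 1) n (by simp) (by simp)).1 (hs n)

/-- The projective resolution given by an exact augmented complex of projectives. -/
noncomputable def CategoryTheory.ProjectiveResolution.ofExact (K : ChainComplex C ℕ)
    (hK : ∀ i, Projective (K.X i)) {X : C} (f : K.X 0 ⟶ X) (w : K.d 1 0 ≫ f = 0)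
    (hf : Epi f) (h0 : (ShortComplex.mk _ _ w).Exact) (hs : ∀ n, K.ExactAt (n + 1)) :
    ProjectiveResolution X where
  complex := K
  projective := hK
  π := (ChainComplex.toSingle₀Equiv _ _).symm ⟨f, w⟩
  quasiIso := ⟨fun n => by
    cases n
    · rw [ChainComplex.quasiIsoAt₀_iff, ShortComplex.quasiIso_iff_of_zeros']
      · refine (ShortComplex.exact_and_epi_g_iff_of_iso ?_).2 ⟨h0, by dsimp; infer_instance⟩
        exact ShortComplex.isoMk (Iso.refl _) (Iso.refl _) (Iso.refl _) 
          (by exact (Category.id_comp _).trans (Category.comp_id _).symm)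
          (by exact (Category.id_comp _).trans ((Category.comp_id _).trans
            (ChainComplex.toSingle₀Equiv_symm_apply_f_zero f w)).symm)
      · exact K.shape 0 0 (by simp)
      all_goals rfl
    · rw [quasiIsoAt_iff_exactAt']
      · exact hs _
      · apply ChainComplex.exactAt_succ_single_obj⟩

/-- A resolution of the syzygy is spliced with the projective above it: the augmentation followed by
the kernel inclusion becomes the new last differential. Exactness at the splice survives because the
former is epi and the latter mono. -/
lemma exists_projectiveResolution_of_hasProjectiveDimensionLE [EnoughProjectives C] (n : ℕ) (X : C)
    (hX : HasProjectiveDimensionLE X n) :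
    ∃ P : ProjectiveResolution X, ∀ i, n < i → IsZero (P.complex.X i) := by
  induction n generalizing X with
  | zero =>
    have := (projective_iff_hasProjectiveDimensionLE_zero X).2 hX
    exact ⟨ProjectiveResolution.self X, fun i hi =>
      HomologicalComplex.isZero_single_obj_X _ _ _ _ (by lia)⟩
  | succ n ih =>
    have hS := kernelProjectiveπ_shortExact X
    obtain ⟨P, hP⟩ := ih _ ((hS.hasProjectiveDimensionLT_X₃_iff n
      (Projective.projective_over X)).1 hX)
    let p : P.complex.X 0 ⟶ kernel (Projective.π X) := P.π.f 0
    have hp : Epi p := inferInstanceAs (Epi (P.π.f 0))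
    have hw : P.complex.d 1 0 ≫ p = 0 := P.complex_d_comp_π_f_zero
    have hex : (ShortComplex.mk _ _ hw).Exact := P.exact₀
    have hw' : P.complex.d 1 0 ≫ p ≫ kernel.ι (Projective.π X) = 0 := by
      rw [← Category.assoc, hw, zero_comp]
    let K := P.complex.augment (p ≫ kernel.ι (Projective.π X)) hw'
    refine ⟨ProjectiveResolution.ofExact K ?_ (Projective.π X) ?_
      (inferInstanceAs (Epi (Projective.π X))) ?_ ?_, ?_⟩
    · rintro (_ | i)
      · exact Projective.projective_over X
      · exact P.projective i
    · change (p ≫ kernel.ι (Projective.π X)) ≫ Projective.π X = 0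
      simp
    · change (ShortComplex.mk (p ≫ kernel.ι (Projective.π X)) (Projective.π X) _).Exact
      let ψ : ShortComplex.mk (p ≫ kernel.ι (Projective.π X)) (Projective.π X) (by simp) ⟶
          ShortComplex.mk (kernel.ι (Projective.π X)) (Projective.π X) (by simp) :=
        { τ₁ := p, τ₂ := 𝟙 _, τ₃ := 𝟙 _ }
      have : Epi ψ.τ₁ := hp
      have : IsIso ψ.τ₂ := inferInstanceAs (IsIso (𝟙 _))
      have : Mono ψ.τ₃ := inferInstanceAs (Mono (𝟙 _))
      exact (ShortComplex.exact_iff_of_epi_of_isIso_of_mono ψ).2 hS.exact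
    · rintro (_ | i)
      · rw [HomologicalComplex.exactAt_iff' _ 2 1 0 (by simp) (by simp)]
        change (ShortComplex.mk (P.complex.d 1 0) (p ≫ kernel.ι (Projective.π X)) hw').Exact
        let ψ : ShortComplex.mk (P.complex.d 1 0) p hw ⟶
            ShortComplex.mk (P.complex.d 1 0) (p ≫ kernel.ι (Projective.π X)) hw' :=
          { τ₁ := 𝟙 _, τ₂ := 𝟙 _, τ₃ := kernel.ι (Projective.π X) }
        have : Epi ψ.τ₁ := inferInstanceAs (Epi (𝟙 _))
        have : IsIso ψ.τ₂ := inferInstanceAs (IsIso (𝟙 _))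
        have : Mono ψ.τ₃ := inferInstanceAs (Mono (kernel.ι (Projective.π X)))
        exact (ShortComplex.exact_iff_of_epi_of_isIso_of_mono ψ).1 hex
      · rw [HomologicalComplex.exactAt_iff' _ (i + 3) (i + 2) (i + 1) (by simp) (by simp)]
        exact P.exact_succ i
    · rintro (_ | i) hi
      · exact absurd hi (by lia)
      · exact hP i (by lia)

end Resolutions

/-! ### Dual bases and dualities for finite dimensional modules -/

namespace FMod

open Opposite

section General

variable {K A : Type u} [Field K] [Ring A] [Algebra K A] [Module.Finite K A]

@[simp] lemma lin_comp {M N L : FMod K A} (f : M ⟶ N) (g : N ⟶ L) (x : M) :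
    lin (f ≫ g) x = lin g (lin f x) := rfl

@[simp] lemma lin_id {M : FMod K A} (x : M) : lin (𝟙 M) x = x := rfl

lemma lin_ofLin {M N : FMod K A} (f : M →ₗ[A] N) : lin (ofLin f) = f := rfl

lemma isIso_of_bijective {M N : FMod K A} (f : M ⟶ N) (h : Function.Bijective (lin f)) :
    IsIso f :=
  let e := LinearEquiv.ofBijective (lin f) h
  ⟨ofLin (e.symm : N →ₗ[A] M), hom_ext fun x => e.symm_apply_apply x,
    hom_ext fun x => e.apply_symm_apply x⟩

lemma epi_of_surjective {M N : FMod K A} (f : M ⟶ N) (h : Function.Surjective (lin f)) :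
    Epi f where
  left_cancellation _ _ hg := hom_ext fun y => by
    obtain ⟨x, rfl⟩ := h y
    exact congrArg (fun k => lin k x) hg

lemma mono_of_injective {M N : FMod K A} (f : M ⟶ N) (h : Function.Injective (lin f)) :
    Mono f where
  right_cancellation _ _ hg := hom_ext fun y => h (congrArg (fun k => lin k y) hg)

lemma surjective_of_epi {M N : FMod K A} (f : M ⟶ N) [Epi f] : Function.Surjective (lin f) := by
  let q : N ⟶ of (N ⧸ LinearMap.range (lin f)) := ofLin (LinearMap.range (lin f)).mkQ
  have hq : f ≫ q = 0 := hom_ext fun x =>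
    (Submodule.Quotient.mk_eq_zero _).2 (LinearMap.mem_range_self (lin f) x)
  have hq' : q = 0 := (cancel_epi f).1 (hq.trans comp_zero.symm)
  intro y
  exact (Submodule.Quotient.mk_eq_zero _).1 (congrArg (fun k => lin k y) hq')

lemma injective_of_mono {M N : FMod K A} (f : M ⟶ N) [Mono f] : Function.Injective (lin f) := by
  -- Needed so that the kernel is finitely generated and can serve as a test object.
  have : IsNoetherianRing A := IsNoetherianRing.of_finite K A
  let q : of (K := K) (LinearMap.ker (lin f)) ⟶ M :=
    ofLin (M := of (LinearMap.ker (lin f))) (LinearMap.ker (lin f)).subtype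
  have hq : q ≫ f = 0 := hom_ext fun x => x.2
  have hq' : q = 0 := (cancel_mono f).1 (hq.trans zero_comp.symm)
  rw [← LinearMap.ker_eq_bot, LinearMap.ker_eq_bot']
  intro x hx
  exact congrArg (fun k => lin k (⟨x, hx⟩ : LinearMap.ker (lin f))) hq'

/-- A free module of finite rank. -/
def free (K A : Type u) [Field K] [Ring A] [Algebra K A] [Module.Finite K A] (m : ℕ) : FMod K A :=
  of (Fin m → A)

/-- A finite dual basis of a module. -/
def HasDualBasis (M : FMod K A) : Prop :=
  ∃ (m : ℕ) (e : Fin m → M) (φ : Fin m → M →ₗ[A] A), ∀ x, ∑ k, φ k x • e k = x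

/-- Lift the images of the generators arbitrarily; the coordinate functionals assemble the lifts
into a linear map. -/
lemma HasDualBasis.projective {M : FMod K A} (h : HasDualBasis M) : Projective M where
  factors {E X} f p hp := by
    obtain ⟨m, e, φ, h⟩ := h
    choose s hs using surjective_of_epi p
    refine ⟨ofLin (∑ k, (φ k).smulRight (s (lin f (e k)))), hom_ext fun x => ?_⟩
    rw [lin_comp, lin_ofLin]
    conv_rhs => rw [← h x]
    simp [LinearMap.sum_apply, hs]

lemma exists_dualBasis_free (m : ℕ) : ∃ (e : Fin m → free K A m)
    (φ : Fin m → free K A m →ₗ[A] A), ∀ x, ∑ k, φ k x • e k = x := by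
  have h : ∀ x : Fin m → A, ∑ k, x k • (Pi.single k (1 : A) : Fin m → A) = x := fun x => by
    ext j
    simp [Finset.sum_apply, Pi.single_apply]
  exact ⟨fun k => (Pi.single k 1 : Fin m → A), fun k => LinearMap.proj k, h⟩

lemma projective_free (m : ℕ) : Projective (free K A m) :=
  HasDualBasis.projective ⟨m, exists_dualBasis_free m⟩

lemma exists_epi_free (M : FMod K A) : ∃ (m : ℕ) (p : free K A m ⟶ M), Epi p := by
  obtain ⟨m, f, hf⟩ := Module.Finite.exists_fin' A M
  exact ⟨m, ofLin (M := free K A m) f, epi_of_surjective _ hf⟩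

instance : EnoughProjectives (FMod K A) where
  presentation M := by
    obtain ⟨m, p, hp⟩ := exists_epi_free M
    exact ⟨{ p := free K A m, projective := projective_free m, f := p }⟩

lemma hasDualBasis_of_projective (P : FMod K A) [Projective P] : HasDualBasis P := by
  obtain ⟨m, p, hp⟩ := exists_epi_free P
  let s := Projective.factorThru (𝟙 P) p
  have hs : s ≫ p = 𝟙 P := Projective.factorThru_comp _ _
  obtain ⟨e, φ, h⟩ := exists_dualBasis_free (K := K) (A := A) m
  refine ⟨m, fun k => lin p (e k), fun k => φ k ∘ₗ lin s, fun x => ?_⟩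
  have := congrArg (fun k => lin k x) hs
  simp only [lin_comp, lin_id] at this
  conv_rhs => rw [← this, ← h (lin s x)]
  simp

end General

section Duality

variable {K Λ : Type u} [Field K] [Ring Λ] [Algebra K Λ] [Module.Finite K Λ]

/-- The biduality morphism `M ⟶ D D M` of a right module. -/
def bidualRight (M : FMod K Λᵐᵒᵖ) : M ⟶ dualLeft.obj (op (dualRight.obj (op M))) :=
  ofLin (N := of (Dual (dualRight.obj (op M))))
    { toFun := fun x =>
        { toFun := fun (φ : Dual M) => φ x
          map_add' := fun _ _ => rfl
          map_smul' := fun r (φ : Dual M) =>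
            (congrArg φ (algebraMap_smul Λᵐᵒᵖ r x)).trans (map_smul φ r x) }
      map_add' := fun x y => LinearMap.ext fun (φ : Dual M) => map_add φ x y
      map_smul' := fun _ _ => rfl }

/-- The biduality morphism `M ⟶ D D M` of a left module. -/
def bidualLeft (M : FMod K Λ) : M ⟶ dualRight.obj (op (dualLeft.obj (op M))) :=
  ofLin (N := of (Dual (dualLeft.obj (op M))))
    { toFun := fun x =>
        { toFun := fun (φ : Dual M) => φ x
          map_add' := fun _ _ => rfl
          map_smul' := fun r (φ : Dual M) =>
            (congrArg φ (algebraMap_smul Λ r x)).trans (map_smul φ r x) }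
      map_add' := fun x y => LinearMap.ext fun (φ : Dual M) => map_add φ x y
      map_smul' := fun _ _ => rfl }

/-- Reduces biduality over $\Lambda$ to vector spaces. `W` is the double dual as a $\Lambda$-module
and `G` reads its elements as $K$-functionals; injectivity of `G` suffices, since `G ∘ F` is the
classical biduality isomorphism. -/
lemma bijective_eval_of_finite {V : Type u} [AddCommGroup V] [Module K V] [Module.Finite K V]
    {W : Type u} (F : V → W) (G : W → Module.Dual K (Module.Dual K V))
    (hG : Function.Injective G) (h : ∀ x φ, G (F x) φ = φ x) : Function.Bijective F := by
  have hGF : G ∘ F = Module.evalEquiv K V := funext fun x => LinearMap.ext fun φ => h x φ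
  have : Function.Bijective (G ∘ F) := hGF ▸ (Module.evalEquiv K V).bijective
  exact ⟨this.1.of_comp, fun w => (this.2 (G w)).imp fun x hx => hG hx⟩

instance (M : FMod K Λᵐᵒᵖ) : IsIso (bidualRight M) := by
  refine isIso_of_bijective _ (bijective_eval_of_finite (K := K) (V := M) _
    (fun (Φ : Dual (dualRight.obj (op M))) =>
      { toFun := fun φ => Φ (φ : Dual M)
        map_add' := fun φ ψ => map_add Φ (φ : Dual M) (ψ : Dual M)
        map_smul' := fun r φ => ?_ }) ?_ fun x φ => rfl)
  · exact (congrArg Φ (algebraMap_smul Λ r (show Dual M from φ)).symm).trans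
      (map_smul Φ r (show dualRight.obj (op M) from φ))
  · intro Φ Ψ h
    exact LinearMap.ext fun φ => LinearMap.congr_fun h φ

instance (M : FMod K Λ) : IsIso (bidualLeft M) := by
  refine isIso_of_bijective _ (bijective_eval_of_finite (K := K) (V := M) _
    (fun (Φ : Dual (dualLeft.obj (op M))) =>
      { toFun := fun φ => Φ (φ : Dual M)
        map_add' := fun φ ψ => map_add Φ (φ : Dual M) (ψ : Dual M)
        map_smul' := fun r φ => ?_ }) ?_ fun x φ => rfl)
  · exact (congrArg Φ (algebraMap_smul Λᵐᵒᵖ r (show Dual M from φ)).symm).trans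
      (map_smul Φ r (show dualLeft.obj (op M) from φ))
  · intro Φ Ψ h
    exact LinearMap.ext fun φ => LinearMap.congr_fun h φ

lemma bidualRight_naturality {M N : FMod K Λᵐᵒᵖ} (f : M ⟶ N) :
    bidualRight M ≫ dualLeft.map (dualRight.map f.op).op = f ≫ bidualRight N := rfl

lemma bidualLeft_naturality {M N : FMod K Λ} (f : M ⟶ N) :
    bidualLeft M ≫ dualRight.map (dualLeft.map f.op).op = f ≫ bidualLeft N := rfl

/-- The evaluation morphism `M ⟶ M**` of a right module. -/
def evalRight (M : FMod K Λᵐᵒᵖ) : M ⟶ homLeft.obj (op (homRight.obj (op M))) :=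
  ofLin (N := of (homRight.obj (op M) →ₗ[Λ] Λ))
    { toFun := fun x =>
        { toFun := fun (φ : M →ₗ[Λᵐᵒᵖ] Λ) => φ x
          map_add' := fun _ _ => rfl
          map_smul' := fun _ _ => rfl }
      map_add' := fun x y => LinearMap.ext fun (φ : M →ₗ[Λᵐᵒᵖ] Λ) => map_add φ x y
      map_smul' := fun a x => LinearMap.ext fun (φ : M →ₗ[Λᵐᵒᵖ] Λ) => map_smul φ a x }

/-- The evaluation morphism `M ⟶ M**` of a left module. -/
def evalLeft (M : FMod K Λ) : M ⟶ homRight.obj (op (homLeft.obj (op M))) :=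
  ofLin (N := of (homLeft.obj (op M) →ₗ[Λᵐᵒᵖ] Λ))
    { toFun := fun x =>
        { toFun := fun (φ : M →ₗ[Λ] Λ) => φ x
          map_add' := fun _ _ => rfl
          map_smul' := fun _ _ => rfl }
      map_add' := fun x y => LinearMap.ext fun (φ : M →ₗ[Λ] Λ) => map_add φ x y
      map_smul' := fun a x => LinearMap.ext fun (φ : M →ₗ[Λ] Λ) => map_smul φ a x }

lemma evalRight_naturality {M N : FMod K Λᵐᵒᵖ} (f : M ⟶ N) :
    evalRight M ≫ homLeft.map (homRight.map f.op).op = f ≫ evalRight N := rfl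

lemma evalLeft_naturality {M N : FMod K Λ} (f : M ⟶ N) :
    evalLeft M ≫ homRight.map (homLeft.map f.op).op = f ≫ evalLeft N := rfl

end Duality

end FMod

/-! ### The Nakayama functors on projectives and injectives -/

namespace FMod

open Opposite

section Nakayama

variable {K Λ : Type u} [Field K] [Ring Λ] [Algebra K Λ] [Module.Finite K Λ]

/-- A finite dual basis of a right module, with values in the right module `Λ`. -/
def HasRightDualBasis (M : FMod K Λᵐᵒᵖ) : Prop :=
  ∃ (m : ℕ) (e : Fin m → M) (φ : Fin m → M →ₗ[Λᵐᵒᵖ] Λ),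
    ∀ x, ∑ k, MulOpposite.op (φ k x) • e k = x

lemma hasRightDualBasis_of_projective (P : FMod K Λᵐᵒᵖ) [Projective P] :
    HasRightDualBasis P := by
  obtain ⟨m, e, φ, h⟩ := hasDualBasis_of_projective P
  exact ⟨m, e, fun k =>
    { toFun := fun x => (φ k x).unop
      map_add' := fun x y => congrArg MulOpposite.unop (map_add (φ k) x y)
      map_smul' := fun a x => congrArg MulOpposite.unop (map_smul (φ k) a x) }, h⟩

lemma HasRightDualBasis.projective {P : FMod K Λᵐᵒᵖ} (h : HasRightDualBasis P) :
    Projective P := by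
  obtain ⟨m, e, φ, h⟩ := h
  exact HasDualBasis.projective ⟨m, e, fun k =>
    { toFun := fun x => MulOpposite.op (φ k x)
      map_add' := fun x y => congrArg MulOpposite.op (map_add (φ k) x y)
      map_smul' := fun a x => congrArg MulOpposite.op (map_smul (φ k) a x) }, h⟩

/-- The coordinate functionals of a dual basis generate the dual module, with evaluation at the
original generators as coordinates. -/
instance projective_homRight_obj (P : FMod K Λᵐᵒᵖ) [Projective P] :
    Projective (homRight.obj (op P)) := by
  obtain ⟨m, e, φ, h⟩ := hasRightDualBasis_of_projective P
  refine HasDualBasis.projective ⟨m, fun k => (φ k : P →ₗ[Λᵐᵒᵖ] Λ), fun k =>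
    { toFun := fun (f : P →ₗ[Λᵐᵒᵖ] Λ) => f (e k)
      map_add' := fun _ _ => rfl
      map_smul' := fun _ _ => rfl }, fun (f : P →ₗ[Λᵐᵒᵖ] Λ) => ?_⟩
  change ∑ k, f (e k) • φ k = f
  ext x
  conv_rhs => rw [← h x]
  simp [LinearMap.sum_apply]

instance projective_homLeft_obj (P : FMod K Λ) [Projective P] :
    Projective (homLeft.obj (op P)) := by
  obtain ⟨m, e, φ, h⟩ := hasDualBasis_of_projective P
  refine HasRightDualBasis.projective ⟨m, fun k => (φ k : P →ₗ[Λ] Λ), fun k =>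
    { toFun := fun (f : P →ₗ[Λ] Λ) => f (e k)
      map_add' := fun _ _ => rfl
      map_smul' := fun _ _ => rfl }, fun (f : P →ₗ[Λ] Λ) => ?_⟩
  change ∑ k, MulOpposite.op (f (e k)) • φ k = f
  ext x
  conv_rhs => rw [← h x]
  simp [LinearMap.sum_apply]

/-- Coordinates determine an element, which gives injectivity; a functional $\Psi$ on $P^*$ is
evaluation at $\sum_k e_k\Psi(\varphi_k)$. -/
instance isIso_evalRight (P : FMod K Λᵐᵒᵖ) [Projective P] : IsIso (evalRight P) := by
  obtain ⟨m, e, φ, h⟩ := hasRightDualBasis_of_projective P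
  refine isIso_of_bijective _ ⟨fun x y hxy => ?_, fun (Ψ : homRight.obj (op P) →ₗ[Λ] Λ) => ?_⟩
  · rw [← h x, ← h y]
    exact Finset.sum_congr rfl fun k _ =>
      congrArg (fun r => MulOpposite.op r • e k) (LinearMap.congr_fun hxy (φ k))
  · refine ⟨∑ k, MulOpposite.op (Ψ (φ k)) • e k, LinearMap.ext fun (f : P →ₗ[Λᵐᵒᵖ] Λ) => ?_⟩
    have hf : ∑ k, f (e k) • φ k = f := by
      ext x
      conv_rhs => rw [← h x]
      simp [LinearMap.sum_apply]
    change f (∑ k, MulOpposite.op (Ψ (φ k)) • e k) = Ψ f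
    have : Ψ f = ∑ k, f (e k) * Ψ (φ k) := by
      conv_lhs => rw [← hf]
      refine (map_sum Ψ _ _).trans (Finset.sum_congr rfl fun k _ => ?_)
      exact map_smul Ψ (f (e k)) (show homRight.obj (op P) from φ k)
    rw [this, map_sum]
    simp

instance isIso_evalLeft (P : FMod K Λ) [Projective P] : IsIso (evalLeft P) := by
  obtain ⟨m, e, φ, h⟩ := hasDualBasis_of_projective P
  refine isIso_of_bijective _ ⟨fun x y hxy => ?_, fun (Ψ : homLeft.obj (op P) →ₗ[Λᵐᵒᵖ] Λ) => ?_⟩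
  · rw [← h x, ← h y]
    exact Finset.sum_congr rfl fun k _ =>
      congrArg (fun r => r • e k) (LinearMap.congr_fun hxy (φ k))
  · refine ⟨∑ k, (Ψ (φ k)) • e k, LinearMap.ext fun (f : P →ₗ[Λ] Λ) => ?_⟩
    have hf : ∑ k, MulOpposite.op (f (e k)) • φ k = f := by
      ext x
      conv_rhs => rw [← h x]
      simp [LinearMap.sum_apply]
    change f (∑ k, (Ψ (φ k)) • e k) = Ψ f
    have : Ψ f = ∑ k, Ψ (φ k) * f (e k) := by
      conv_lhs => rw [← hf]
      refine (map_sum Ψ _ _).trans (Finset.sum_congr rfl fun k _ => ?_)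
      exact map_smul Ψ (MulOpposite.op (f (e k))) (show homLeft.obj (op P) from φ k)
    rw [this, map_sum]
    simp

/-- A monomorphism has a $K$-linear retraction, along which functionals extend. -/
lemma epi_dualRight_map {M N : FMod K Λᵐᵒᵖ} (f : M ⟶ N) [Mono f] : Epi (dualRight.map f.op) :=
  epi_of_surjective _ fun (φ : Dual M) => by
    obtain ⟨r, hr⟩ := ((lin f).restrictScalars K).exists_leftInverse_of_injective
      (LinearMap.ker_eq_bot.2 (injective_of_mono f))
    refine ⟨(LinearMap.comp (M₂ := M) φ r : Dual N), LinearMap.ext fun x => ?_⟩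
    exact congrArg φ (LinearMap.congr_fun hr x)

lemma bidual_triangle (N : FMod K Λ) :
    bidualRight (dualLeft.obj (op N)) ≫ dualLeft.map (bidualLeft N).op = 𝟙 _ := rfl

/-- Extending $g\colon X\to DN$ along $X\hookrightarrow Y$ is, after transposing, lifting $N\to DX$
along the epimorphism $DY\to DX$. -/
instance injective_dualLeft_obj (N : FMod K Λ) [Projective N] :
    Injective (dualLeft.obj (op N)) where
  factors {X Y} g f hf := by
    have := epi_dualRight_map f
    let k : N ⟶ dualRight.obj (op Y) :=
      Projective.factorThru (bidualLeft N ≫ dualRight.map g.op) (dualRight.map f.op)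
    have hk : k ≫ dualRight.map f.op = bidualLeft N ≫ dualRight.map g.op :=
      Projective.factorThru_comp _ _
    refine ⟨bidualRight Y ≫ dualLeft.map k.op, ?_⟩
    rw [← Category.assoc, ← bidualRight_naturality, Category.assoc, ← Functor.map_comp,
      ← op_comp, hk, op_comp, Functor.map_comp, ← Category.assoc, bidualRight_naturality,
      Category.assoc, bidual_triangle, Category.comp_id]

lemma mono_dualLeft_map {M N : FMod K Λ} (f : M ⟶ N) [Epi f] :
    Mono (dualLeft.map f.op) :=
  mono_of_injective _ fun (φ : Dual N) (ψ : Dual N) h => LinearMap.ext fun y => by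
    obtain ⟨x, rfl⟩ := surjective_of_epi f y
    exact LinearMap.congr_fun h x

lemma exists_mono_dualLeft_free (M : FMod K Λᵐᵒᵖ) :
    ∃ (m : ℕ) (i : M ⟶ dualLeft.obj (op (free K Λ m))), Mono i := by
  obtain ⟨m, p, hp⟩ := exists_epi_free (dualRight.obj (op M))
  have := mono_dualLeft_map p
  exact ⟨m, bidualRight M ≫ dualLeft.map p.op, mono_comp _ _⟩

instance : EnoughInjectives (FMod K Λᵐᵒᵖ) where
  presentation M := by
    obtain ⟨m, i, hi⟩ := exists_mono_dualLeft_free M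
    have := projective_free (K := K) (A := Λ) m
    exact ⟨{ J := dualLeft.obj (op (free K Λ m)), injective := inferInstance, f := i }⟩

/-- An injective is a retract of the dual of a free module, so its dual is a retract of a free
module. -/
instance projective_dualRight_obj (I : FMod K Λᵐᵒᵖ) [Injective I] :
    Projective (dualRight.obj (op I)) := by
  obtain ⟨m, i, hi⟩ := exists_mono_dualLeft_free I
  have := projective_free (K := K) (A := Λ) m
  have : Projective (dualRight.obj (op (dualLeft.obj (op (free K Λ m))))) :=
    Projective.of_iso (asIso (bidualLeft (free K Λ m))) inferInstance
  let r := Injective.factorThru (𝟙 I) i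
  have hr : i ≫ r = 𝟙 I := Injective.comp_factorThru _ _
  exact Retract.projective ⟨dualRight.map r.op, dualRight.map i.op, by
    rw [← Functor.map_comp, ← op_comp, hr, op_id, CategoryTheory.Functor.map_id]⟩

variable (K Λ)

/-- The natural transformation `M ⟶ ν⁻¹ν M` on modules. -/
noncomputable def nuUnit : 𝟭 (FMod K Λᵐᵒᵖ) ⟶ nu₀ K Λ ⋙ nuInv₀ K Λ where
  app M := evalRight M ≫ homLeft.map (inv (bidualLeft (homRight.obj (op M)))).op
  naturality M N f := by
    have h1 := evalRight_naturality f
    have h2 := bidualLeft_naturality (homRight.map f.op)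
    rw [← IsIso.eq_inv_comp, ← Category.assoc, ← IsIso.comp_inv_eq] at h2
    change f ≫ evalRight N ≫ homLeft.map (inv (bidualLeft (homRight.obj (op N)))).op =
      (evalRight M ≫ homLeft.map (inv (bidualLeft (homRight.obj (op M)))).op) ≫
        homLeft.map (dualRight.map (dualLeft.map (homRight.map f.op).op).op).op
    rw [Category.assoc, ← Functor.map_comp, ← op_comp, h2, op_comp, Functor.map_comp,
      ← Category.assoc, ← Category.assoc, h1]

/-- The natural transformation `νν⁻¹ M ⟶ M` on modules. -/
noncomputable def nuCounit : nuInv₀ K Λ ⋙ nu₀ K Λ ⟶ 𝟭 (FMod K Λᵐᵒᵖ) where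
  app M := dualLeft.map (evalLeft (dualRight.obj (op M))).op ≫
    (inv (bidualRight M) : dualLeft.obj (op (dualRight.obj (op M))) ⟶ M)
  naturality M N f := by
    have h1 := bidualRight_naturality f
    have h2 := evalLeft_naturality (dualRight.map f.op)
    rw [← IsIso.eq_inv_comp, ← Category.assoc, ← IsIso.comp_inv_eq] at h1
    change dualLeft.map (homRight.map (homLeft.map (dualRight.map f.op).op).op).op ≫
      dualLeft.map (evalLeft (dualRight.obj (op N))).op ≫ inv (bidualRight N) =
      (dualLeft.map (evalLeft (dualRight.obj (op M))).op ≫ inv (bidualRight M)) ≫ f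
    rw [Category.assoc, ← h1, ← Category.assoc, ← Category.assoc, ← Functor.map_comp,
      ← Functor.map_comp, ← op_comp, ← op_comp, h2]

variable {K Λ}

instance isIso_nuUnit_app (P : FMod K Λᵐᵒᵖ) [Projective P] : IsIso ((nuUnit K Λ).app P) := by
  exact inferInstanceAs (IsIso (evalRight P ≫
    homLeft.map (inv (bidualLeft (homRight.obj (op P)))).op))

instance isIso_nuCounit_app (I : FMod K Λᵐᵒᵖ) [Injective I] : IsIso ((nuCounit K Λ).app I) := by
  exact inferInstanceAs (IsIso (dualLeft.map (evalLeft (dualRight.obj (op I))).op ≫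
    (inv (bidualRight I) : dualLeft.obj (op (dualRight.obj (op I))) ⟶ I)))

instance injective_nu₀_obj (P : FMod K Λᵐᵒᵖ) [Projective P] : Injective ((nu₀ K Λ).obj P) :=
  inferInstanceAs (Injective (dualLeft.obj (op (homRight.obj (op P)))))

instance projective_nuInv₀_obj (I : FMod K Λᵐᵒᵖ) [Injective I] :
    Projective ((nuInv₀ K Λ).obj I) :=
  inferInstanceAs (Projective (homLeft.obj (op (dualRight.obj (op I)))))

end Nakayama

end FMod

/-! ### Transfer of Hom-vanishing along the derived Nakayama functor -/

section DerivedNakayama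

open DerivedCategory

variable {K Λ : Type u} [Field K] [Ring Λ] [Algebra K Λ] [Module.Finite K Λ]

lemma isProjectiveModel_iff (X : DMod K Λ) (P : CochainComplex (FMod K Λᵐᵒᵖ) ℤ) :
    IsProjectiveModel X P ↔ IsBoundedComplexIn (isProjective _) P ∧ Nonempty (Q.obj P ≅ X) :=
  ⟨fun h => ⟨⟨h.bounded, h.projective⟩, h.iso⟩, fun h => ⟨h.1.bounded, h.1.prop, h.2⟩⟩

lemma isInjectiveModel_iff (X : DMod K Λ) (I : CochainComplex (FMod K Λᵐᵒᵖ) ℤ) :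
    IsInjectiveModel X I ↔ IsBoundedComplexIn (isInjective _) I ∧ Nonempty (Q.obj I ≅ X) :=
  ⟨fun h => ⟨⟨h.bounded, h.injective⟩, h.iso⟩, fun h => ⟨h.1.bounded, h.1.prop, h.2⟩⟩

/-- No boundedness of `X` is required: without a projective model, `nu X` is zero by definition. -/
lemma bounded_nu (X : DMod K Λ) : TStructure.t.bounded (nu X) := by
  by_cases h : ∃ P, IsProjectiveModel X P
  · obtain ⟨P, hP⟩ := h
    have hP' := ((isProjectiveModel_iff X P).1 hP).1
    exact TStructure.t.bounded.prop_of_iso (nu_iso hP).some.symm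
      (hP'.map (F := FMod.nu₀ K Λ) (R' := ⊤) fun _ _ => trivial).bounded_Q_obj
  · rw [nu, dif_neg h]
    exact TStructure.t.bounded.prop_of_isZero (isZero_zero _)

lemma bounded_nuInv (X : DMod K Λ) : TStructure.t.bounded (nuInv X) := by
  by_cases h : ∃ I, IsInjectiveModel X I
  · obtain ⟨I, hI⟩ := h
    have hI' := ((isInjectiveModel_iff X I).1 hI).1
    exact TStructure.t.bounded.prop_of_iso (nuInv_iso hI).some.symm
      (hI'.map (F := FMod.nuInv₀ K Λ) (R' := ⊤) fun _ _ => trivial).bounded_Q_obj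
  · rw [nuInv, dif_neg h]
    exact TStructure.t.bounded.prop_of_isZero (isZero_zero _)

variable {n : ℕ} (hn : ∀ X : FMod K Λᵐᵒᵖ, HasProjectiveDimensionLE X n)

include hn

lemma exists_isProjectiveModel (X : DMod K Λ) (hX : TStructure.t.bounded X) :
    ∃ P, IsProjectiveModel X P :=
  (hasBoundedModel_isProjective_of_bounded n hn X hX).imp fun P => (isProjectiveModel_iff X P).2

lemma exists_isInjectiveModel (X : DMod K Λ) (hX : TStructure.t.bounded X) :
    ∃ I, IsInjectiveModel X I :=
  (hasBoundedModel_isInjective_of_bounded n hn X hX).imp fun I => (isInjectiveModel_iff X I).2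

/-- `nu` is not a functor here, so isomorphism invariance comes from one complex modelling both
objects. -/
lemma nonempty_nu_iso_of_iso {X Y : DMod K Λ} (hX : TStructure.t.bounded X) (e : X ≅ Y) :
    Nonempty (nu X ≅ nu Y) := by
  obtain ⟨P, hP⟩ := exists_isProjectiveModel hn X hX
  exact ⟨(nu_iso hP).some ≪≫
    (nu_iso (X := Y) ⟨hP.bounded, hP.projective, hP.iso.map (· ≪≫ e)⟩).some.symm⟩

lemma nonempty_nuInv_iso_of_iso {X Y : DMod K Λ} (hX : TStructure.t.bounded X) (e : X ≅ Y) :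
    Nonempty (nuInv X ≅ nuInv Y) := by
  obtain ⟨I, hI⟩ := exists_isInjectiveModel hn X hX
  exact ⟨(nuInv_iso hI).some ≪≫
    (nuInv_iso (X := Y) ⟨hI.bounded, hI.injective, hI.iso.map (· ≪≫ e)⟩).some.symm⟩

lemma nonempty_nu_shift_iso {X : DMod K Λ} (hX : TStructure.t.bounded X) (j : ℤ) :
    Nonempty (nu (X⟦j⟧) ≅ (nu X)⟦j⟧) := by
  obtain ⟨P, hP⟩ := exists_isProjectiveModel hn X hX
  obtain ⟨hP₁, ⟨e⟩⟩ := (isProjectiveModel_iff X P).1 hP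
  have hPj : IsProjectiveModel (X⟦j⟧) (P⟦j⟧) := (isProjectiveModel_iff _ _).2
    ⟨hP₁.shift j, ⟨(Q.commShiftIso j).app P ≪≫ (shiftFunctor (DMod K Λ) j).mapIso e⟩⟩
  exact ⟨(nu_iso hPj).some ≪≫
    Q.mapIso ((((FMod.nu₀ K Λ).mapHomologicalComplex (.up ℤ)).commShiftIso j).app P) ≪≫
    (Q.commShiftIso j).app (((FMod.nu₀ K Λ).mapHomologicalComplex (.up ℤ)).obj P) ≪≫ (shiftFunctor (DMod K Λ) j).mapIso (nu_iso hP).some.symm⟩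

lemma nonempty_nuInv_shift_iso {X : DMod K Λ} (hX : TStructure.t.bounded X) (j : ℤ) :
    Nonempty (nuInv (X⟦j⟧) ≅ (nuInv X)⟦j⟧) := by
  obtain ⟨P, hP⟩ := exists_isInjectiveModel hn X hX
  obtain ⟨hP₁, ⟨e⟩⟩ := (isInjectiveModel_iff X P).1 hP
  have hPj : IsInjectiveModel (X⟦j⟧) (P⟦j⟧) := (isInjectiveModel_iff _ _).2
    ⟨hP₁.shift j, ⟨(Q.commShiftIso j).app P ≪≫ (shiftFunctor (DMod K Λ) j).mapIso e⟩⟩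
  exact ⟨(nuInv_iso hPj).some ≪≫
    Q.mapIso ((((FMod.nuInv₀ K Λ).mapHomologicalComplex (.up ℤ)).commShiftIso j).app P) ≪≫
    (Q.commShiftIso j).app (((FMod.nuInv₀ K Λ).mapHomologicalComplex (.up ℤ)).obj P) ≪≫ (shiftFunctor (DMod K Λ) j).mapIso (nuInv_iso hP).some.symm⟩

/-- With a projective model $P$ of $X$ and an injective model $I$ of $Y$, both Hom groups are groups
of homotopy classes, $P\to\nu^{-1}I$ and $\nu P\to I$, so the chain-level transfer applies. -/
lemma HomVanishes.nu_left {X Y : DMod K Λ} (hY : TStructure.t.bounded Y)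
    (h : HomVanishes X (nuInv Y)) : HomVanishes (nu X) Y := by
  by_cases hX : ∃ P, IsProjectiveModel X P
  · obtain ⟨P, hP⟩ := hX
    obtain ⟨I, hI⟩ := exists_isInjectiveModel hn Y hY
    obtain ⟨hP₁, ⟨e⟩⟩ := (isProjectiveModel_iff X P).1 hP
    obtain ⟨hI₁, ⟨e'⟩⟩ := (isInjectiveModel_iff Y I).1 hI
    have := hP₁.isKProjective
    have := hI₁.isKInjective
    have hp : ∀ i, Projective (P.X i) := hP.projective
    have h' := h.of_iso e.symm (nuInv_iso hI).some
    rw [homVanishes_Q_obj_iff (CochainComplex.IsKProjective.Qh_map_bijective _ _)] at h'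
    refine HomVanishes.of_iso ?_ (nu_iso hP).some.symm e'
    rw [homVanishes_Q_obj_iff (CochainComplex.IsKInjective.Qh_map_bijective _ _)]
    exact nonempty_homotopy_zero_of_forall_to_map _ _ (FMod.nuUnit K Λ) (FMod.nuCounit K Λ)
      (fun i => inferInstance) (fun i => inferInstance) h'
  · rw [nu, dif_neg hX]
    exact fun f => (isZero_zero _).eq_of_src _ _

/-- Now $X$ has an injective and $Y$ a projective model. Homotopy classes still compute Hom because
$\nu$ sends projectives to injectives and $\nu^{-1}$ sends injectives to projectives. -/
lemma HomVanishes.nuInv_left {X Y : DMod K Λ} (hY : TStructure.t.bounded Y)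
    (h : HomVanishes X (nu Y)) : HomVanishes (nuInv X) Y := by
  by_cases hX : ∃ I, IsInjectiveModel X I
  · obtain ⟨I, hI⟩ := hX
    obtain ⟨P, hP⟩ := exists_isProjectiveModel hn Y hY
    obtain ⟨hI₁, ⟨e⟩⟩ := (isInjectiveModel_iff X I).1 hI
    obtain ⟨hP₁, ⟨e'⟩⟩ := (isProjectiveModel_iff Y P).1 hP
    have hp : ∀ i, Projective (P.X i) := hP.projective
    have hi : ∀ i, Injective (I.X i) := hI.injective
    have := (hP₁.map (F := FMod.nu₀ K Λ) (R' := isInjective _)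
      fun _ (_ : Projective _) => inferInstance).isKInjective
    have := (hI₁.map (F := FMod.nuInv₀ K Λ) (R' := isProjective _)
      fun _ (_ : Injective _) => inferInstance).isKProjective
    have h' := h.of_iso e.symm (nu_iso hP).some
    rw [homVanishes_Q_obj_iff (CochainComplex.IsKInjective.Qh_map_bijective _ _)] at h'
    refine HomVanishes.of_iso ?_ (nuInv_iso hI).some.symm e'
    rw [homVanishes_Q_obj_iff (CochainComplex.IsKProjective.Qh_map_bijective _ _)]
    exact nonempty_homotopy_zero_of_forall_from_map (FMod.nu₀ K Λ) (FMod.nuInv₀ K Λ)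
      (FMod.nuUnit K Λ) (FMod.nuCounit K Λ)
      (fun i => inferInstance) (fun i => inferInstance) h'
  · rw [nuInv, dif_neg hX]
    exact fun f => (isZero_zero _).eq_of_src _ _

variable (m : ℤ)

lemma HomVanishes.nu_shift_left {X Y : DMod K Λ} (hY : TStructure.t.bounded Y)
    (h : HomVanishes X (nuInv (Y⟦m⟧))) : HomVanishes (nu (X⟦-m⟧)) Y :=
  HomVanishes.nu_left hn hY ((h.shift (-m)).of_iso (Iso.refl _)
    ((shiftFunctor (DMod K Λ) (-m)).mapIso (nonempty_nuInv_shift_iso hn hY m).some ≪≫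
      (shiftFunctorCompIsoId (DMod K Λ) m (-m) (by simp)).app _))

lemma HomVanishes.nuInv_shift_left {X Y : DMod K Λ} (hY : TStructure.t.bounded Y)
    (h : HomVanishes X (nu (Y⟦-m⟧))) : HomVanishes (nuInv (X⟦m⟧)) Y :=
  HomVanishes.nuInv_left hn hY ((h.shift m).of_iso (Iso.refl _)
    ((shiftFunctor (DMod K Λ) m).mapIso (nonempty_nu_shift_iso hn hY (-m)).some ≪≫
      (shiftFunctorCompIsoId (DMod K Λ) (-m) m (by simp)).app _))

lemma HomVanishes.iterate_nu_left (i : ℕ) {X Y : DMod K Λ} (hY : TStructure.t.bounded Y)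
    (h : HomVanishes X ((fun Y => nuInv (Y⟦m⟧))^[i] Y)) :
    HomVanishes ((fun X => nu (X⟦-m⟧))^[i] X) Y := by
  induction i generalizing Y with
  | zero => exact h
  | succ i ih =>
    rw [Function.iterate_succ_apply']
    -- The outermost functor on the left moves first, so the induction hypothesis is used for the
    -- modified target, which is always bounded.
    exact HomVanishes.nu_shift_left hn m hY (ih (bounded_nuInv _) h)

lemma HomVanishes.iterate_nuInv_left (i : ℕ) {X Y : DMod K Λ} (hY : TStructure.t.bounded Y)
    (h : HomVanishes X ((fun Y => nu (Y⟦-m⟧))^[i] Y)) :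
    HomVanishes ((fun X => nuInv (X⟦m⟧))^[i] X) Y := by
  induction i generalizing Y with
  | zero => exact h
  | succ i ih =>
    rw [Function.iterate_succ_apply']
    exact HomVanishes.nuInv_shift_left hn m hY (ih (bounded_nu _) h)

lemma nonempty_iterate_nu_shift_iso (i : ℕ) (j : ℤ) {Y : DMod K Λ}
    (hY : TStructure.t.bounded Y) :
    Nonempty ((fun Y => nu (Y⟦m⟧))^[i] (Y⟦j⟧) ≅ ((fun Y => nu (Y⟦m⟧))^[i] Y)⟦j⟧) := by
  induction i with
  | zero => exact ⟨Iso.refl _⟩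
  | succ i ih =>
    rw [Function.iterate_succ_apply', Function.iterate_succ_apply']
    have hb : TStructure.t.bounded ((fun Y : DMod K Λ => nu (Y⟦m⟧))^[i] Y) := by
      cases i with
      | zero => exact hY
      | succ i => rw [Function.iterate_succ_apply']; exact bounded_nu _
    obtain ⟨e⟩ := ih
    obtain ⟨e'⟩ := nonempty_nu_iso_of_iso hn
      (ObjectProperty.le_shift _ _ _ (ObjectProperty.le_shift _ _ _ hb))
      ((shiftFunctor (DMod K Λ) m).mapIso e ≪≫ (shiftFunctorComm (DMod K Λ) j m).app _).symm
    exact ⟨e'.symm ≪≫ (nonempty_nu_shift_iso hn (ObjectProperty.le_shift _ _ _ hb) j).some⟩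

lemma nonempty_iterate_nuInv_shift_iso (i : ℕ) (j : ℤ) {Y : DMod K Λ}
    (hY : TStructure.t.bounded Y) :
    Nonempty ((fun Y => nuInv (Y⟦m⟧))^[i] (Y⟦j⟧) ≅ ((fun Y => nuInv (Y⟦m⟧))^[i] Y)⟦j⟧) := by
  induction i with
  | zero => exact ⟨Iso.refl _⟩
  | succ i ih =>
    rw [Function.iterate_succ_apply', Function.iterate_succ_apply']
    have hb : TStructure.t.bounded ((fun Y : DMod K Λ => nuInv (Y⟦m⟧))^[i] Y) := by
      cases i with
      | zero => exact hY
      | succ i => rw [Function.iterate_succ_apply']; exact bounded_nuInv _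
    obtain ⟨e⟩ := ih
    obtain ⟨e'⟩ := nonempty_nuInv_iso_of_iso hn
      (ObjectProperty.le_shift _ _ _ (ObjectProperty.le_shift _ _ _ hb))
      ((shiftFunctor (DMod K Λ) m).mapIso e ≪≫ (shiftFunctorComm (DMod K Λ) j m).app _).symm
    exact ⟨e'.symm ≪≫ (nonempty_nuInv_shift_iso hn (ObjectProperty.le_shift _ _ _ hb) j).some⟩

end DerivedNakayama

/-! ### Projective modules lie in $\mathcal C^0$ -/

section ProjectivesInC0

open DerivedCategory

variable {K Λ : Type u} [Field K] [Ring Λ] [Algebra K Λ] [Module.Finite K Λ]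

instance projective_regular : Projective (FMod.regular K Λ) :=
  FMod.HasRightDualBasis.projective
    ⟨1, fun _ => (1 : Λ), fun _ => (LinearMap.id : Λ →ₗ[Λᵐᵒᵖ] Λ), fun (x : Λ) =>
      (Fin.sum_univ_one (fun _ => MulOpposite.op x • (1 : Λ))).trans (one_mul x)⟩

lemma bounded_singleFunctor_obj (M : FMod K Λᵐᵒᵖ) :
    TStructure.t.bounded ((singleFunctor (FMod K Λᵐᵒᵖ) 0).obj M) :=
  ⟨⟨0, inferInstance⟩, ⟨0, inferInstance⟩⟩

lemma iterate_nuInv_regular (n i : ℕ) :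
    (fun X => nuInv (X⟦(n : ℤ)⟧))^[i] ((singleFunctor _ 0).obj (FMod.regular K Λ)) =
      nuPow K Λ n (-(i : ℤ)) := by
  cases i with
  | zero => rfl
  | succ i => rfl

lemma isZero_homology_shift {X : DMod K Λ} (j : ℤ)
    (h : IsZero ((homologyFunctor _ j).obj X)) : IsZero ((homologyFunctor _ 0).obj (X⟦j⟧)) :=
  h.of_iso (((homologyFunctor _ 0).shiftIso j 0 j (by simp)).app X)

/-- The only place where the cohomological half of the $n$-hereditary condition enters. Moving
$\nu_n^i$ across turns the claim into vanishing of maps from the projective $\Lambda$ to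
$\nu_n^{-i}(\Lambda)[j]$, controlled by $H^j(\nu_n^{-i}\Lambda)$. -/
lemma homVanishes_nuPow_regular {n : ℕ} (hΛ : IsNHereditary K Λ n) (i j : ℤ)
    (hj : ¬ (n : ℤ) ∣ j) : HomVanishes (nuPow K Λ n i)
      (((singleFunctor _ 0).obj (FMod.regular K Λ))⟦j⟧) := by
  have hb := bounded_singleFunctor_obj (FMod.regular K Λ)
  have hbj := ObjectProperty.le_shift _ j _ hb
  have key : HomVanishes ((singleFunctor _ 0).obj (FMod.regular K Λ))
      ((nuPow K Λ n (-i))⟦j⟧) :=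
    homVanishes_singleFunctor_of_isZero_homology _ _
      (isZero_homology_shift j (hΛ.isZero_homology (-i) j hj))
  cases i with
  | ofNat i =>
    refine HomVanishes.iterate_nu_left hΛ.gldim n i hbj (key.of_iso (Iso.refl _) ?_)
    exact (eqToIso (by rw [iterate_nuInv_regular]; rfl)) ≪≫
      (nonempty_iterate_nuInv_shift_iso hΛ.gldim n i j hb).some.symm
  | negSucc i =>
    refine HomVanishes.iterate_nuInv_left hΛ.gldim n (i + 1) hbj (key.of_iso (Iso.refl _) ?_)
    exact (nonempty_iterate_nu_shift_iso hΛ.gldim (-n) (i + 1) j hb).some.symm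

lemma homVanishes_of_catU {n : ℕ} {U Y : DMod K Λ} (hU : catU K Λ n U)
    (h : ∀ i, HomVanishes (nuPow K Λ n i) Y) : HomVanishes U Y := fun f => by
  obtain ⟨m, j, V, ⟨e⟩⟩ := hU
  have h0 : e.inv ≫ biprod.fst ≫ f = 0 := biproduct.hom_ext' _ _ fun k =>
    (h _ _).trans comp_zero.symm
  have h1 : (biprod.fst : U ⊞ V ⟶ U) ≫ f = 0 := by
    rw [← cancel_epi e.inv, h0, comp_zero]
  rw [← Category.id_comp f, ← biprod.inl_fst (X := U) (Y := V), Category.assoc, h1, comp_zero]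

lemma FMod.lin_sum {A : Type u} [Ring A] [Algebra K A] [Module.Finite K A] {M N : FMod K A}
    {m : ℕ} (f : Fin m → (M ⟶ N)) (x : M) : lin (∑ k, f k) x = ∑ k, lin (f k) x :=
  map_sum ({ toFun := fun g => lin g x, map_zero' := rfl, map_add' := fun _ _ => rfl } :
    (M ⟶ N) →+ N) f Finset.univ

lemma exists_sum_comp_regular_eq_id (P : FMod K Λᵐᵒᵖ) [Projective P] :
    ∃ (m : ℕ) (p : Fin m → (P ⟶ FMod.regular K Λ)) (q : Fin m → (FMod.regular K Λ ⟶ P)),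
      ∑ k, p k ≫ q k = 𝟙 P := by
  obtain ⟨m, e, φ, h⟩ := FMod.hasRightDualBasis_of_projective P
  refine ⟨m, fun k => FMod.ofLin (N := FMod.regular K Λ) (φ k), fun k =>
    FMod.ofLin (M := FMod.regular K Λ)
      { toFun := fun (a : Λ) => MulOpposite.op a • e k
        map_add' := fun (a b : Λ) => add_smul (MulOpposite.op a) (MulOpposite.op b) (e k)
        map_smul' := fun c (a : Λ) => mul_smul c (MulOpposite.op a) (e k) }, ?_⟩
  exact FMod.hom_ext fun x => (FMod.lin_sum _ x).trans (h x)

/-- The identity of $P$ is a sum of maps factoring through $\Lambda$, so every map to $P[j]$ is a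
sum of maps factoring through $\Lambda[j]$. -/
lemma homVanishes_shift_projective {U : DMod K Λ} {j : ℤ}
    (h : HomVanishes U (((singleFunctor _ 0).obj (FMod.regular K Λ))⟦j⟧))
    (P : FMod K Λᵐᵒᵖ) [Projective P] : HomVanishes U (((singleFunctor _ 0).obj P)⟦j⟧) :=
  fun f => by
    obtain ⟨m, p, q, hpq⟩ := exists_sum_comp_regular_eq_id P
    let F := singleFunctor (FMod K Λᵐᵒᵖ) 0 ⋙ shiftFunctor (DMod K Λ) j
    have h1 : f ≫ F.map (∑ k, p k ≫ q k) = f := by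
      rw [hpq, CategoryTheory.Functor.map_id]
      exact Category.comp_id f
    rw [← h1, F.map_sum, Preadditive.comp_sum]
    refine Finset.sum_eq_zero fun k _ => ?_
    rw [F.map_comp, ← Category.assoc, h (f ≫ F.map (p k)), zero_comp]

lemma catC0_of_projective {n : ℕ} (hΛ : IsNHereditary K Λ n) (P : FMod K Λᵐᵒᵖ)
    (hP : Projective P) : catC0 K Λ n P :=
  ⟨bounded_singleFunctor_obj P, fun _ hU j hj => homVanishes_of_catU hU fun i =>
    homVanishes_shift_projective (homVanishes_nuPow_regular hΛ i j hj) P⟩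

end ProjectivesInC0

/-! ### Universal property of the split Grothendieck group -/

section SplitK0

variable {C : Type u} [Category.{v} C] [Preadditive C] {A : Type*} [AddCommGroup A]

lemma SplitK0.cls_bicone {X Y : C} (b : BinaryBicone X Y) (hb : b.IsBilimit) :
    SplitK0.cls b.pt = SplitK0.cls X + SplitK0.cls Y := by
  refine QuotientAddGroup.eq_iff_sub_mem.2 (AddSubgroup.subset_closure (Or.inr ⟨X, Y, b, ⟨hb⟩, ?_⟩))
  rw [sub_sub]

/-- The universal property of the split Grothendieck group. -/
noncomputable def SplitK0.lift (f : C → A) (hiso : ∀ X Y : C, (X ≅ Y) → f X = f Y)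
    (hadd : ∀ (X Y : C) (b : BinaryBicone X Y), b.IsBilimit → f b.pt = f X + f Y) :
    SplitK0 C →+ A :=
  QuotientAddGroup.lift _ (FreeAbelianGroup.lift f) <| (AddSubgroup.closure_le _).2 <| by
    rintro r (⟨X, Y, ⟨e⟩, rfl⟩ | ⟨X, Y, b, ⟨hb⟩, rfl⟩)
    · simp [AddMonoidHom.mem_ker, hiso X Y e]
    · simp [AddMonoidHom.mem_ker, hadd X Y b hb]

@[simp]
lemma SplitK0.lift_cls (f : C → A) (hiso : ∀ X Y : C, (X ≅ Y) → f X = f Y)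
    (hadd : ∀ (X Y : C) (b : BinaryBicone X Y), b.IsBilimit → f b.pt = f X + f Y) (X : C) :
    SplitK0.lift f hiso hadd (SplitK0.cls X) = f X :=
  FreeAbelianGroup.lift_apply_of f X

lemma SplitK0.hom_ext {f g : SplitK0 C →+ A}
    (h : ∀ X : C, f (SplitK0.cls X) = g (SplitK0.cls X)) : f = g :=
  QuotientAddGroup.addMonoidHom_ext _ (FreeAbelianGroup.lift_ext _ _ h)

end SplitK0

/-! ### Universal property of the abelian Grothendieck group -/

section K0

variable {C : Type u} [Category.{v} C] [Abelian C] {A : Type*} [AddCommGroup A]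

lemma K0.cls_shortExact {S : ShortComplex C} (hS : S.ShortExact) :
    K0.cls S.X₂ = K0.cls S.X₁ + K0.cls S.X₃ := by
  have h : (QuotientAddGroup.mk (SplitK0.cls S.X₁ - SplitK0.cls S.X₂ + SplitK0.cls S.X₃) : K0 C) = 0 :=
    (QuotientAddGroup.eq_zero_iff _).2 (AddSubgroup.subset_closure ⟨S, hS, rfl⟩)
  change K0.cls S.X₁ - K0.cls S.X₂ + K0.cls S.X₃ = 0 at h
  rw [eq_comm, ← sub_eq_zero, ← h]
  abel

lemma eq_add_of_binary_total_of_additive {χ : C → A}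
    (hχ : ∀ S : ShortComplex C, S.ShortExact → χ S.X₂ = χ S.X₁ + χ S.X₃)
    {X Y : C} {b : BinaryBicone X Y} (hb : b.fst ≫ b.inl + b.snd ≫ b.inr = 𝟙 b.pt) :
    χ b.pt = χ X + χ Y :=
  hχ (ShortComplex.mk b.inl b.snd b.inl_snd) (ShortComplex.Splitting.shortExact
    { r := b.fst
      s := b.inr
      f_r := b.inl_fst
      s_g := b.inr_snd
      id := hb })

/-- The universal property of the Grothendieck group of an abelian category. -/
noncomputable def K0.lift (χ : C → A)
    (hχ : ∀ S : ShortComplex C, S.ShortExact → χ S.X₂ = χ S.X₁ + χ S.X₃) : K0 C →+ A :=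
  QuotientAddGroup.lift _
    (SplitK0.lift χ (fun _ _ e => eq_of_iso_of_additive hχ e)
      fun _ _ _ hb => eq_add_of_binary_total_of_additive hχ (IsBilimit.binary_total hb)) <|
    (AddSubgroup.closure_le _).2 <| by
      rintro r ⟨S, hS, rfl⟩
      simp [AddMonoidHom.mem_ker, hχ S hS]

@[simp]
lemma K0.lift_cls (χ : C → A)
    (hχ : ∀ S : ShortComplex C, S.ShortExact → χ S.X₂ = χ S.X₁ + χ S.X₃) (X : C) :
    K0.lift χ hχ (K0.cls X) = χ X :=
  FreeAbelianGroup.lift_apply_of _ X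

lemma K0.hom_ext {f g : K0 C →+ A} (h : ∀ X : C, f (K0.cls X) = g (K0.cls X)) : f = g :=
  QuotientAddGroup.addMonoidHom_ext _ (SplitK0.hom_ext h)

end K0

/-! ### Additive functions on augmented resolutions -/

section Euler

variable {C : Type*} [Category* C] [Abelian C] {A : Type*} [AddCommGroup A]

/-- A projective resolution of `X`, augmented by `X`. -/
noncomputable def CategoryTheory.ProjectiveResolution.augmented {X : C}
    (P : ProjectiveResolution X) : ChainComplex C ℕ :=
  P.complex.augment (X := X) (P.π.f 0) P.complex_d_comp_π_f_zero

lemma CategoryTheory.ProjectiveResolution.augmented_exactAt {X : C} (P : ProjectiveResolution X)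
    (i : ℕ) : P.augmented.ExactAt i := by
  have : Epi (Y := X) (P.π.f 0) := inferInstanceAs (Epi (P.π.f 0))
  exact augment_exactAt P.complex (X := X) (P.π.f 0) _ P.exact₀ P.complex_exactAt_succ i

lemma CategoryTheory.ProjectiveResolution.isZero_augmented {X : C} {P : ProjectiveResolution X}
    {n : ℕ} (hP : ∀ i, n < i → IsZero (P.complex.X i)) (i : ℕ) (hi : n + 1 < i) :
    IsZero (P.augmented.X i) := by
  obtain ⟨j, rfl⟩ := Nat.exists_eq_add_of_lt hi
  exact hP _ (by omega)

lemma sum_range_succ_neg_one_pow_smul (f : ℕ → A) (m : ℕ) :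
    ∑ i ∈ Finset.range (m + 1), (-1 : ℤ) ^ i • f i =
      f 0 - ∑ i ∈ Finset.range m, (-1 : ℤ) ^ i • f (i + 1) := by
  rw [Finset.sum_range_succ', pow_zero, one_smul, add_comm, sub_eq_add_neg, ← Finset.sum_neg_distrib]
  simp [pow_succ]

lemma CategoryTheory.ProjectiveResolution.eq_sum_of_additive {χ : C → A}
    (hχ : ∀ S : ShortComplex C, S.ShortExact → χ S.X₂ = χ S.X₁ + χ S.X₃)
    {X : C} (P : ProjectiveResolution X) {n : ℕ} (hP : ∀ i, n < i → IsZero (P.complex.X i)) :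
    χ X = ∑ i ∈ Finset.range (n + 1), (-1 : ℤ) ^ i • χ (P.complex.X i) := by
  have h := sum_eq_zero_of_exactAt hχ P.augmented P.augmented_exactAt (n + 1)
    (P.isZero_augmented hP)
  rw [sum_range_succ_neg_one_pow_smul (fun i => χ (P.augmented.X i))] at h
  exact sub_eq_zero.1 h

end Euler

/-! ### Comparison of the two Grothendieck groups -/

section ExactK0

variable {C : Type u} [Category.{v} C] [Abelian C] {S : ObjectProperty C} {n : ℕ}
  {A : Type*} [AddCommGroup A]

lemma ExactK0.hom_ext {f g : ExactK0 S n →+ A}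
    (h : ∀ X : S.FullSubcategory, f (ExactK0.cls n X) = g (ExactK0.cls n X)) : f = g :=
  QuotientAddGroup.addMonoidHom_ext _ (SplitK0.hom_ext h)

lemma ExactK0.sum_cls_eq_zero (E : ChainComplex S.FullSubcategory ℕ)
    (h0 : ∀ i, n + 1 < i → IsZero (E.X i))
    (hE : ∀ i, ((S.ι.mapHomologicalComplex _).obj E).ExactAt i) :
    ∑ i ∈ Finset.range (n + 2), (-1 : ℤ) ^ i • ExactK0.cls n (E.X i) = 0 := by
  have h := (QuotientAddGroup.eq_zero_iff _).2 (AddSubgroup.subset_closure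
    (show _ ∈ {r : SplitK0 S.FullSubcategory | ∃ E : ChainComplex S.FullSubcategory ℕ,
      (∀ i, n + 1 < i → IsZero (E.X i)) ∧
      (∀ i, ((S.ι.mapHomologicalComplex _).obj E).ExactAt i) ∧
      r = ∑ i ∈ Finset.range (n + 2), (-1 : ℤ) ^ i • SplitK0.cls (E.X i)} from
      ⟨E, h0, hE, rfl⟩))
  refine Eq.trans ?_ h
  let q : SplitK0 S.FullSubcategory →+ ExactK0 S n := QuotientAddGroup.mk' _
  refine (Eq.trans ?_ (map_sum q _ _).symm)
  exact Finset.sum_congr rfl fun i _ => (map_zsmul q _ _).symm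

/-- The sequence splits, and the splitting is a biproduct inside the full subcategory, so the
relation already holds in the split Grothendieck group. -/
lemma ExactK0.cls_shortExact_of_projective
    {T : ShortComplex C} (hT : T.ShortExact) [Projective T.X₃] (h₁ : S T.X₁) (h₂ : S T.X₂)
    (h₃ : S T.X₃) :
    ExactK0.cls n (⟨T.X₂, h₂⟩ : S.FullSubcategory) =
      ExactK0.cls n ⟨T.X₁, h₁⟩ + ExactK0.cls n ⟨T.X₃, h₃⟩ := by
  let σ := hT.splittingOfProjective
  let b : BinaryBicone (⟨T.X₁, h₁⟩ : S.FullSubcategory) ⟨T.X₃, h₃⟩ :=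
    { pt := ⟨T.X₂, h₂⟩
      fst := S.homMk σ.r
      snd := S.homMk T.g
      inl := S.homMk T.f
      inr := S.homMk σ.s
      inl_fst := ObjectProperty.hom_ext _ σ.f_r
      inl_snd := ObjectProperty.hom_ext _ T.zero
      inr_fst := ObjectProperty.hom_ext _ σ.s_r
      inr_snd := ObjectProperty.hom_ext _ σ.s_g }
  have hb : b.IsBilimit := isBinaryBilimitOfTotal b (ObjectProperty.hom_ext _ σ.id)
  exact congrArg (QuotientAddGroup.mk' _ : SplitK0 S.FullSubcategory →+ ExactK0 S n)
    (SplitK0.cls_bicone b hb)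

/-- A complex in `C` with terms in `S`, as a complex in `S`. -/
def ChainComplex.toFullSubcategory (E : ChainComplex C ℕ) (hE : ∀ i, S (E.X i)) :
    ChainComplex S.FullSubcategory ℕ where
  X i := ⟨E.X i, hE i⟩
  d i j := S.homMk (E.d i j)
  shape i j h := ObjectProperty.hom_ext _ (E.shape i j h)
  d_comp_d' i j k _ _ := ObjectProperty.hom_ext _ (E.d_comp_d i j k)

/-- The augmented resolution has $X$ in degree $0$ and $P_i$ in degree $i+1$, hence at most $n+2$
nonzero terms, all in `S`: it is one of the defining relations. -/
lemma ExactK0.cls_eq_sum {X : C} (P : ProjectiveResolution X)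
    (hP : ∀ i, n < i → IsZero (P.complex.X i)) (hproj : ∀ Q : C, Projective Q → S Q) (hX : S X) :
    ExactK0.cls n (⟨X, hX⟩ : S.FullSubcategory) = ∑ i ∈ Finset.range (n + 1),
      (-1 : ℤ) ^ i • ExactK0.cls n ⟨P.complex.X i, hproj _ (P.projective i)⟩ := by
  have hS : ∀ i, S (P.augmented.X i)
    | 0 => hX
    | i + 1 => hproj _ (P.projective i)
  have h := ExactK0.sum_cls_eq_zero (n := n) (P.augmented.toFullSubcategory hS)
    (fun i hi => IsZero.of_full_of_faithful_of_isZero S.ι _ (P.isZero_augmented hP i hi))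
    P.augmented_exactAt
  rw [sum_range_succ_neg_one_pow_smul
    (fun i => ExactK0.cls n ((P.augmented.toFullSubcategory hS).X i))] at h
  exact sub_eq_zero.1 h

variable (S n) in
/-- The comparison map from the Grothendieck group of `S` to the one of the ambient category. -/
noncomputable def ExactK0.toK0 : ExactK0 S n →+ K0 C :=
  have hχ : ∀ T : ShortComplex C, T.ShortExact → K0.cls T.X₂ = K0.cls T.X₁ + K0.cls T.X₃ :=
    fun _ hT => K0.cls_shortExact hT
  QuotientAddGroup.lift _
    (SplitK0.lift (fun X : S.FullSubcategory => K0.cls X.obj)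
      (fun _ _ e => eq_of_iso_of_additive hχ (S.ι.mapIso e))
      fun _ _ b hb => eq_add_of_binary_total_of_additive hχ
        (b := S.ι.mapBinaryBicone b)
        (congrArg (fun f => f.hom) (IsBilimit.binary_total hb))) <|
    (AddSubgroup.closure_le _).2 <| by
      rintro r ⟨E, h0, hE, rfl⟩
      simp only [SetLike.mem_coe, AddMonoidHom.mem_ker, map_sum, map_zsmul]
      exact sum_eq_zero_of_exactAt hχ _ hE (n + 1) fun i hi => S.ι.map_isZero (h0 i hi)

@[simp]
lemma ExactK0.toK0_cls (X : S.FullSubcategory) :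
    ExactK0.toK0 S n (ExactK0.cls n X) = K0.cls X.obj :=
  FreeAbelianGroup.lift_apply_of (fun X : S.FullSubcategory => K0.cls X.obj) X

variable (hproj : ∀ Q : C, Projective Q → S Q)

open Classical in
/-- The class in `ExactK0 S n` of a projective object, extended by zero. -/
noncomputable def ExactK0.projectiveClass (n : ℕ) (hproj : ∀ Q : C, Projective Q → S Q) (X : C) :
    ExactK0 S n :=
  if h : Projective X then ExactK0.cls n ⟨X, hproj X h⟩ else 0

lemma ExactK0.projectiveClass_of_projective (P : C) [h : Projective P] :
    ExactK0.projectiveClass n hproj P = ExactK0.cls n ⟨P, hproj P h⟩ :=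
  dif_pos h

lemma ExactK0.isAdditiveOnProjectives_projectiveClass :
    IsAdditiveOnProjectives (ExactK0.projectiveClass n hproj) := by
  intro T hT h₁ h₂ h₃
  simp only [ExactK0.projectiveClass_of_projective]
  exact ExactK0.cls_shortExact_of_projective hT _ _ _

variable [EnoughProjectives C] (hn : ∀ X : C, HasProjectiveDimensionLE X n)

/-- The map `K0 C →+ ExactK0 S n` given by projective resolutions. -/
noncomputable def ExactK0.ofK0 : K0 C →+ ExactK0 S n :=
  K0.lift (resolutionClass (ExactK0.projectiveClass n hproj) n) fun T hT =>
    resolutionClassAdditive (ExactK0.isAdditiveOnProjectives_projectiveClass hproj) n T hT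
      (hn _) (hn _) (hn _)

lemma ExactK0.ofK0_cls_of_projective (P : C) (h : Projective P) :
    ExactK0.ofK0 hproj hn (K0.cls P) = ExactK0.cls n ⟨P, hproj P h⟩ := by
  rw [ExactK0.ofK0, K0.lift_cls, resolutionClass_of_projective
    (ExactK0.isAdditiveOnProjectives_projectiveClass hproj),
    ExactK0.projectiveClass_of_projective]

lemma ExactK0.ofK0_cls {X : C} (P : ProjectiveResolution X)
    (hP : ∀ i, n < i → IsZero (P.complex.X i)) :
    ExactK0.ofK0 hproj hn (K0.cls X) = ∑ i ∈ Finset.range (n + 1),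
      (-1 : ℤ) ^ i • ExactK0.cls n ⟨P.complex.X i, hproj _ (P.projective i)⟩ := by
  rw [P.eq_sum_of_additive (fun _ hT => K0.cls_shortExact hT) hP, map_sum]
  exact Finset.sum_congr rfl fun i _ => by
    rw [map_zsmul, ExactK0.ofK0_cls_of_projective hproj hn _ (P.projective i)]

/-- If `S` contains the projective objects of an abelian category of global dimension at most `n`,
then the Grothendieck group of `S` is the one of the ambient category. -/
noncomputable def ExactK0.equivK0 : ExactK0 S n ≃+ K0 C :=
  AddMonoidHom.toAddEquiv (ExactK0.toK0 S n) (ExactK0.ofK0 hproj hn)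
    -- On `S`, both sides equal the alternating sum over a resolution: by construction of the
    -- inverse and by the exact-sequence relation.
    (ExactK0.hom_ext fun X => by
      obtain ⟨P, hP⟩ := exists_projectiveResolution_of_hasProjectiveDimensionLE n X.obj (hn _)
      rw [AddMonoidHom.comp_apply, ExactK0.toK0_cls, ExactK0.ofK0_cls hproj hn P hP]
      exact (ExactK0.cls_eq_sum P hP hproj X.property).symm)
    -- On the ambient category the same sum equals the class of `X` by the Euler characteristic.
    (K0.hom_ext fun X => by
      obtain ⟨P, hP⟩ := exists_projectiveResolution_of_hasProjectiveDimensionLE n X (hn _)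
      rw [AddMonoidHom.comp_apply, ExactK0.ofK0_cls hproj hn P hP, map_sum]
      simp only [map_zsmul, ExactK0.toK0_cls]
      exact (P.eq_sum_of_additive (fun _ hT => K0.cls_shortExact hT) hP).symm)

end ExactK0

theorem mainTheorem6 (K Λ : Type u) [Field K] [Ring Λ] [Algebra K Λ] [Module.Finite K Λ]
    (n : ℕ) (hn : 0 < n) (hΛ : IsNHereditary K Λ n) :
    ∃ (hproj : ∀ P : FMod K Λᵐᵒᵖ, Projective P → catC0 K Λ n P)
      (α : ExactK0 (catC0 K Λ n) n ≃+ K0 (FMod K Λᵐᵒᵖ)),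
      (∀ X : (catC0 K Λ n).FullSubcategory, α (ExactK0.cls n X) = K0.cls X.obj) ∧
      ∀ X : FMod K Λᵐᵒᵖ,
        (∃ P : ProjectiveResolution X, ∀ i, n < i → IsZero (P.complex.X i)) ∧
        ∀ P : ProjectiveResolution X, (∀ i, n < i → IsZero (P.complex.X i)) →
          α.symm (K0.cls X) = ∑ i ∈ Finset.range (n + 1),
            (-1 : ℤ) ^ i • ExactK0.cls n ⟨P.complex.X i, hproj _ (P.projective i)⟩ := by
  have hproj : ∀ P : FMod K Λᵐᵒᵖ, Projective P → catC0 K Λ n P :=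
    fun P hP => catC0_of_projective hΛ P hP
  refine ⟨hproj, ExactK0.equivK0 hproj hΛ.gldim, fun X => ExactK0.toK0_cls (n := n) X, fun X => ⟨?_, ?_⟩⟩
  · exact exists_projectiveResolution_of_hasProjectiveDimensionLE n X (hΛ.gldim X)
  · exact fun P hP => ExactK0.ofK0_cls hproj hΛ.gldim P hP
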